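/- \textbf{Channel.} Let $n_{11},n_{12},n_{21},n_{22}$ be nonnegative integers and $q=\max_{i,j} n_{ij}$. In the two-user deterministic interference channel user $i$ sends $x_i\in\mathbb F_2^q$ (first entry most significant) in each channel use, and receiver $i$ observes $y_i=S^{q-n_{i1}}x_1\oplus S^{q-n_{i2}}x_2$, where $S$ is the $q\times q$ down-shift matrix. A pair $(r_1,r_2)$ of nonnegative reals is achievable if for all $\epsilon>0$, $0<\mu<1$ and all sufficiently large $N$ there is a code of block length $N$ with $M_i$ messages for user $i$ such that $\frac1N\log_2 M_i\ge r_i-\epsilon$ and such that, on average over uniform messages, each receiver decodes its own message with probability at least $1-\mu$. \textbf{Splitting.} For $\{i,j\}=\{1,2\}$ let $x_{ic}$ be the highest $n_{ji}$ levels of $x_i$ and $x_{ip}$ the next $(n_{ii}-n_{ji})^+$ levels (any remaining levels reach no receiver and are set to zero), where $a^+=\max(a,0)$. A split code has message sets $\mathcal M_i=\mathcal M_{ic}\times\mathcal M_{ip}$, common signals $x_{ic}^N=f_i^c(m_{ic})$ and private signals $x_{ip}^N=f_i^p(m_{ic},m_{ip})$; receiver $i$ decodes $m_{ic},m_{ip}$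 and also the other user's common message $m_{jc}$. Call nonnegative $(r_1^c,r_1^p,r_2^c,r_2^p)$ split-achievable if for all $\epsilon>0$, $0<\mu<1$ and all sufficiently large $N$ there is a split code of block length $N$ with $\frac1N\log_2|\mathcal M_{ic}|\ge r_i^c-\epsilon$ and $\frac1N\log_2|\mathcal M_{ip}|\ge r_i^p-\epsilon$, whose common rates satisfy $\frac1N\log_2|\mathcal M_{ic}|\le\frac1N H(x_{ic}^N)$ and $r_i^c-\epsilon<\frac1N H(x_{ic}^N)$ for uniform messages, and for which, on average over uniform messages, each receiver decodes its three messages with probability at least $1-\mu$. \textbf{Statement.} (1) $(r_1,r_2)$ is achievable if and only if $r_i=r_i^c+r_i^p$ $(i=1,2)$ for some split-achievable $(r_1^c,r_1^p,r_2^c,r_2^p)$. (2) A nonnegative tuple $(r_1^c,r_1^p,r_2^c,r_2^p)$ is split-achievable if and only if there are a finite time-sharing variable $Q$ and a law $p(q)\prod_{i}p(x_{ic}|q)\,p(x_{ip}|x_{ic},q)$ such that, for $i=1,2$ and $j\ne i$, \begin{align*} r_i^c+r_i^p+r_j^c&\le I(x_{ic},x_{ip},x_{jc};y_i|Q), & r_i^c+r_i^p&\le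 I(x_{ic},x_{ip};y_i|x_{jc},Q), & r_j^c&\le I(x_{jc};y_i|x_{ic},x_{ip},Q),\\ r_i^p+r_j^c&\le I(x_{ip},x_{jc};y_i|x_{ic},Q), & r_i^p&\le I(x_{ip};y_i|x_{jc},x_{ic},Q). \end{align*} (3) Each of these ten mutual informations is at most its value when $Q$ is constant and $x_{1c},x_{1p},x_{2c},x_{2p}$ are independent and uniform; hence the region in (2) equals the region given by the ten constraints for uniform inputs. (4) The region in (2) is the set of nonnegative $(r_1^c,r_1^p,r_2^c,r_2^p)$ satisfying \begin{align*} r_1^c+r_1^p+r_2^c&\le n_{11}+\min(n_{22},(n_{12}-n_{11})^+) & r_2^c+r_2^p+r_1^c&\le n_{22}+\min(n_{11},(n_{21}-n_{22})^+)\\ r_1^c+r_1^p&\le n_{11} & r_2^c+r_2^p&\le n_{22}\\ r_2^c&\le\min(n_{12},n_{22}) & r_1^c&\le\min(n_{21},n_{11})\\ r_1^p+r_2^c&\le\min\bigl(n_{22}+(n_{11}-n_{21})^+,\max(n_{12},(n_{11}-n_{21})^+)\bigr) & r_2^p+r_1^c&\le\min\bigl(n_{11}+(n_{22}-n_{12})^+,\max(n_{21},(n_{22}-n_{12})^+)\bigr)\\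 r_1^p&\le(n_{11}-n_{21})^+ & r_2^p&\le(n_{22}-n_{12})^+ . \end{align*} -/

import Mathlib

namespace DetIC

/-! ### The channel

The gains are `n : Fin 2 → Fin 2 → ℕ`; `n i j` is the number of levels of transmitter `j` that
arrive above the noise at receiver `i`.  Users are numbered `0` and `1`. -/

/-- The other user. -/
def other (i : Fin 2) : Fin 2 := 1 - i

/-- Vectors of `m` bits with entries in `𝔽₂`; index `0` is the most significant level. -/
abbrev Bits (m : ℕ) : Type := Fin m → ZMod 2

/-- `q = max_{i,j} n i j`. -/
def levels (n : Fin 2 → Fin 2 → ℕ) : ℕ :=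
  max (max (n 0 0) (n 0 1)) (max (n 1 0) (n 1 1))

/-- Multiplication by the `d`-th power of the `q × q` down-shift matrix: every bit moves `d` levels
down, the `d` least significant bits are lost, and zeros enter at the top. -/
def shiftDown {q : ℕ} (d : ℕ) (x : Bits q) : Bits q := fun k =>
  if d ≤ (k : ℕ) then x ⟨(k : ℕ) - d, lt_of_le_of_lt (Nat.sub_le _ _) k.isLt⟩ else 0

/-- The output at receiver `i` in one channel use: `S^(q - n i 0) x₀ ⊕ S^(q - n i 1) x₁`. -/
def output (n : Fin 2 → Fin 2 → ℕ) (i : Fin 2) (x : Fin 2 → Bits (levels n)) : Bits (levels n) :=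
  ∑ j, shiftDown (levels n - n i j) (x j)

/-! ### Codes and achievable rate pairs -/

/-- A code of block length `N` with `M i` messages for user `i`.  The decoding sets of receiver `i`
are the fibres of `dec i`. -/
structure Code (n : Fin 2 → Fin 2 → ℕ) (N : ℕ) (M : Fin 2 → ℕ) where
  enc : ∀ i, Fin (M i) → Fin N → Bits (levels n)
  dec : ∀ i, (Fin N → Bits (levels n)) → Fin (M i)

/-- What receiver `i` observes over the block when the messages are `m`. -/
def Code.received {n : Fin 2 → Fin 2 → ℕ} {N : ℕ} {M : Fin 2 → ℕ} (C : Code n N M) (i : Fin 2)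
    (m : ∀ j, Fin (M j)) : Fin N → Bits (levels n) :=
  fun t => output n i (fun j => C.enc j (m j) t)

/-- Average probability, over uniform messages, that receiver `i` decodes message `i`. -/
noncomputable def Code.success {n : Fin 2 → Fin 2 → ℕ} {N : ℕ} {M : Fin 2 → ℕ} (C : Code n N M)
    (i : Fin 2) : ℝ :=
  ((Finset.univ.filter fun m : ∀ j, Fin (M j) => C.dec i (C.received i m) = m i).card : ℝ)
    / ((M 0 : ℝ) * (M 1 : ℝ))

/-- The rate pair `r` (bits per channel use) is achievable on the interference channel. -/
def Achievable (n : Fin 2 → Fin 2 → ℕ) (r : Fin 2 → ℝ) : Prop :=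
  (∀ i, 0 ≤ r i) ∧
  ∀ ε : ℝ, 0 < ε → ∀ μ : ℝ, 0 < μ → μ < 1 → ∃ N₀ : ℕ, ∀ N : ℕ, N₀ ≤ N →
    ∃ (M : Fin 2 → ℕ) (C : Code n N M),
      (∀ i, r i - ε ≤ Real.logb 2 (M i) / N) ∧ ∀ i, 1 - μ ≤ C.success i

/-! ### Common and private signals -/

/-- Common signal of user `i`: its highest `n (other i) i` levels, the ones that the other receiver
observes. -/
abbrev Common (n : Fin 2 → Fin 2 → ℕ) (i : Fin 2) : Type := Bits (n (other i) i)

/-- Private signal of user `i`: the `(n i i - n (other i) i)⁺` levels (truncated subtraction) below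
the common ones that its own receiver observes. -/
abbrev Priv (n : Fin 2 → Fin 2 → ℕ) (i : Fin 2) : Type := Bits (n i i - n (other i) i)

/-- The pair (common signal, private signal) of user `i`. -/
abbrev Signal (n : Fin 2 → Fin 2 → ℕ) (i : Fin 2) : Type := Common n i × Priv n i

/-- The channel input with given common and private signals; levels that neither receiver observes
are set to zero. -/
def merge (n : Fin 2 → Fin 2 → ℕ) (i : Fin 2) (s : Signal n i) : Bits (levels n) := fun k =>
  if hc : (k : ℕ) < n (other i) i then s.1 ⟨k, hc⟩
  else if hp : (k : ℕ) < n i i then s.2 ⟨(k : ℕ) - n (other i) i, by omega⟩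
  else 0

/-- The output at receiver `i` as a function of the common and private signals of both users. -/
def outputOf (n : Fin 2 → Fin 2 → ℕ) (i : Fin 2) (x : ∀ j, Signal n j) : Bits (levels n) :=
  output n i (fun j => merge n j (x j))

/-! ### Entropy and mutual information of finite random variables, in bits -/

section Entropy

variable {Ω α β γ : Type} [Fintype Ω]
  [Fintype α] [DecidableEq α] [Fintype β] [DecidableEq β] [Fintype γ] [DecidableEq γ]

/-- Shannon entropy of `X` under the probability mass function `p`. -/
noncomputable def entropy (p : Ω → ℝ) (X : Ω → α) : ℝ :=
  (∑ a, Real.negMulLog (∑ ω with X ω = a, p ω)) / Real.log 2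

/-- `H(X | Z)`. -/
noncomputable def condEntropy (p : Ω → ℝ) (X : Ω → α) (Z : Ω → γ) : ℝ :=
  entropy p (fun ω => (X ω, Z ω)) - entropy p Z

/-- `I(X ; Y | Z)`. -/
noncomputable def condMutualInfo (p : Ω → ℝ) (X : Ω → α) (Y : Ω → β) (Z : Ω → γ) : ℝ :=
  condEntropy p X Z - condEntropy p X (fun ω => (Y ω, Z ω))

end Entropy

/-! ### Codes with common and private messages, both receivers decoding both common messages -/

/-- A code of block length `N` in which user `i` has `Mc i` common and `Mp i` private messages.  The
common signal depends on the common message only, the private signal on both.  Receiver `i` decodes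
its own common and private messages and the common message of the other user. -/
structure SplitCode (n : Fin 2 → Fin 2 → ℕ) (N : ℕ) (Mc Mp : Fin 2 → ℕ) where
  encC : ∀ i, Fin (Mc i) → Fin N → Common n i
  encP : ∀ i, Fin (Mc i) → Fin (Mp i) → Fin N → Priv n i
  dec : ∀ i, (Fin N → Bits (levels n)) → Fin (Mc i) × Fin (Mp i) × Fin (Mc (other i))

/-- What receiver `i` observes over the block when the (common, private) messages are `m`. -/
def SplitCode.received {n : Fin 2 → Fin 2 → ℕ} {N : ℕ} {Mc Mp : Fin 2 → ℕ}
    (C : SplitCode n N Mc Mp) (i : Fin 2) (m : ∀ j, Fin (Mc j) × Fin (Mp j)) :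
    Fin N → Bits (levels n) :=
  fun t => outputOf n i (fun j => (C.encC j (m j).1 t, C.encP j (m j).1 (m j).2 t))

/-- Average probability, over uniform messages, that receiver `i` decodes its two own messages and
the other user's common message. -/
noncomputable def SplitCode.success {n : Fin 2 → Fin 2 → ℕ} {N : ℕ} {Mc Mp : Fin 2 → ℕ}
    (C : SplitCode n N Mc Mp) (i : Fin 2) : ℝ :=
  ((Finset.univ.filter fun m : ∀ j, Fin (Mc j) × Fin (Mp j) =>
      C.dec i (C.received i m) = ((m i).1, (m i).2, (m (other i)).1)).card : ℝ)
    / ((Mc 0 : ℝ) * (Mp 0 : ℝ) * (Mc 1 : ℝ) * (Mp 1 : ℝ))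

/-- Entropy of the length-`N` common signal of user `i` when the messages are uniform. -/
noncomputable def SplitCode.commonEntropy {n : Fin 2 → Fin 2 → ℕ} {N : ℕ} {Mc Mp : Fin 2 → ℕ}
    (C : SplitCode n N Mc Mp) (i : Fin 2) : ℝ :=
  entropy (fun _ : Fin (Mc i) => ((Mc i : ℝ))⁻¹) (C.encC i)

/-- The rates `rc i` (common) and `rp i` (private) are achievable with split codes where each
receiver decodes the other user's common message, and where the common rate does not exceed the
entropy of the common signal. -/
def SplitAchievable (n : Fin 2 → Fin 2 → ℕ) (rc rp : Fin 2 → ℝ) : Prop :=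
  (∀ i, 0 ≤ rc i ∧ 0 ≤ rp i) ∧
  ∀ ε : ℝ, 0 < ε → ∀ μ : ℝ, 0 < μ → μ < 1 → ∃ N₀ : ℕ, ∀ N : ℕ, N₀ ≤ N →
    ∃ (Mc Mp : Fin 2 → ℕ) (C : SplitCode n N Mc Mp),
      (∀ i, rc i - ε ≤ Real.logb 2 (Mc i) / N ∧ rp i - ε ≤ Real.logb 2 (Mp i) / N) ∧
      (∀ i, Real.logb 2 (Mc i) / N ≤ C.commonEntropy i / N ∧
        rc i - ε < C.commonEntropy i / N) ∧
      ∀ i, 1 - μ ≤ C.success i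

/-! ### The single-letter compound-MAC region -/

/-- A joint law `p(q) ∏ᵢ p(x_ic | q) p(x_ip | x_ic, q)` of a time-sharing variable and the signals
of both users. -/
structure InputLaw (n : Fin 2 → Fin 2 → ℕ) (Q : Type) [Fintype Q] where
  timeShare : Q → ℝ
  common : ∀ i, Q → Common n i → ℝ
  priv : ∀ i, Q → Common n i → Priv n i → ℝ
  timeShare_mem : timeShare ∈ stdSimplex ℝ Q
  common_mem : ∀ i q, common i q ∈ stdSimplex ℝ (Common n i)
  priv_mem : ∀ i q c, priv i q c ∈ stdSimplex ℝ (Priv n i)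

section Region

variable {n : Fin 2 → Fin 2 → ℕ} {Q : Type} [Fintype Q] [DecidableEq Q]

/-- The joint probability mass function. -/
def InputLaw.pmf (p : InputLaw n Q) (ω : Q × (∀ j, Signal n j)) : ℝ :=
  p.timeShare ω.1 * ∏ i, p.common i ω.1 (ω.2 i).1 * p.priv i ω.1 (ω.2 i).1 (ω.2 i).2

/-- The five mutual informations at receiver `i`, with `j = other i`:
`I(x_ic,x_ip,x_jc; y_i | Q)`, `I(x_ic,x_ip; y_i | x_jc,Q)`, `I(x_jc; y_i | x_ic,x_ip,Q)`,
`I(x_ip,x_jc; y_i | x_ic,Q)`, `I(x_ip; y_i | x_jc,x_ic,Q)`. -/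
noncomputable def InputLaw.info (p : InputLaw n Q) (i : Fin 2) : Fin 5 → ℝ :=
  ![condMutualInfo p.pmf (fun ω => ((ω.2 i).1, (ω.2 i).2, (ω.2 (other i)).1))
      (fun ω => outputOf n i ω.2) (fun ω => ω.1),
    condMutualInfo p.pmf (fun ω => ((ω.2 i).1, (ω.2 i).2))
      (fun ω => outputOf n i ω.2) (fun ω => ((ω.2 (other i)).1, ω.1)),
    condMutualInfo p.pmf (fun ω => (ω.2 (other i)).1)
      (fun ω => outputOf n i ω.2) (fun ω => ((ω.2 i).1, (ω.2 i).2, ω.1)),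
    condMutualInfo p.pmf (fun ω => ((ω.2 i).2, (ω.2 (other i)).1))
      (fun ω => outputOf n i ω.2) (fun ω => ((ω.2 i).1, ω.1)),
    condMutualInfo p.pmf (fun ω => (ω.2 i).2)
      (fun ω => outputOf n i ω.2) (fun ω => ((ω.2 (other i)).1, (ω.2 i).1, ω.1))]

/-- The rate sums bounded by the five mutual informations at receiver `i`. -/
def rateSums (rc rp : Fin 2 → ℝ) (i : Fin 2) : Fin 5 → ℝ :=
  ![rc i + rp i + rc (other i), rc i + rp i, rc (other i), rp i + rc (other i), rp i]

/-- The rates are nonnegative and satisfy the constraints of both receivers under the law `p`. -/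
def InputLaw.InRegion (p : InputLaw n Q) (rc rp : Fin 2 → ℝ) : Prop :=
  (∀ i, 0 ≤ rc i ∧ 0 ≤ rp i) ∧ ∀ i k, rateSums rc rp i k ≤ p.info i k

end Region

/-- The compound-MAC region: all input laws, with time sharing over any finite set. -/
def InMACRegion (n : Fin 2 → Fin 2 → ℕ) (rc rp : Fin 2 → ℝ) : Prop :=
  ∃ (k : ℕ) (p : InputLaw n (Fin k)), p.InRegion rc rp

/-- A constant function of total mass one is a probability vector. -/
theorem const_mem_stdSimplex (α : Type) [Fintype α] [Nonempty α] :
    (fun _ : α => ((Fintype.card α : ℝ))⁻¹) ∈ stdSimplex ℝ α := by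
  refine ⟨fun _ => by positivity, ?_⟩
  simp

/-- All four signals uniform (hence independent), no time sharing. -/
noncomputable def uniformLaw (n : Fin 2 → Fin 2 → ℕ) : InputLaw n (Fin 1) where
  timeShare := fun _ => ((Fintype.card (Fin 1) : ℝ))⁻¹
  common := fun i _ _ => ((Fintype.card (Common n i) : ℝ))⁻¹
  priv := fun i _ _ _ => ((Fintype.card (Priv n i) : ℝ))⁻¹
  timeShare_mem := const_mem_stdSimplex _
  common_mem := fun _ _ => const_mem_stdSimplex _
  priv_mem := fun _ _ _ => const_mem_stdSimplex _

/-- The explicit constraints on nonnegative rates; `a⁺ = max a 0`. -/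
def InExplicitRegion (n : Fin 2 → Fin 2 → ℕ) (rc rp : Fin 2 → ℝ) : Prop :=
  let n₁₁ : ℝ := n 0 0
  let n₁₂ : ℝ := n 0 1
  let n₂₁ : ℝ := n 1 0
  let n₂₂ : ℝ := n 1 1
  (∀ i, 0 ≤ rc i ∧ 0 ≤ rp i) ∧
  rc 0 + rp 0 + rc 1 ≤ n₁₁ + min n₂₂ (n₁₂ - n₁₁)⁺ ∧
  rc 0 + rp 0 ≤ n₁₁ ∧
  rc 1 ≤ min n₁₂ n₂₂ ∧
  rp 0 + rc 1 ≤ min (n₂₂ + (n₁₁ - n₂₁)⁺) (max n₁₂ (n₁₁ - n₂₁)⁺) ∧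
  rp 0 ≤ (n₁₁ - n₂₁)⁺ ∧
  rc 1 + rp 1 + rc 0 ≤ n₂₂ + min n₁₁ (n₂₁ - n₂₂)⁺ ∧
  rc 1 + rp 1 ≤ n₂₂ ∧
  rc 0 ≤ min n₂₁ n₁₁ ∧
  rp 1 + rc 0 ≤ min (n₁₁ + (n₂₂ - n₁₂)⁺) (max n₂₁ (n₂₂ - n₁₂)⁺) ∧
  rp 1 ≤ (n₂₂ - n₁₂)⁺

end DetIC

/-! The channel is linear over `𝔽₂`. In constraint `l` of receiver `i`, setting the conditioned
components to zero leaves the subspace `freeSignals n i l`. Its image at the receiver is exactly the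
space of vectors supported on the lowest `capBits n i l` levels (`outputOf_mem_lowBits`,
`exists_outputOf_eq`). These ten integers describe every region in the theorem: each one is shown to
coincide with, or project from, the polyhedron `InBitRegion`.

Mutual informations: since the channel is deterministic, each equals `H(y_i | Z)`. Given `Z` the
output lies in one coset of the image, so the value is at most `capBits`, and uniform signals make
the output uniform on that coset (`InputLaw.info_le`, `uniformLaw_info`). The explicit constraints
are the same bounds with redundant terms added.

Split codes: for random linear generators, a message difference governed by constraint `l` is
received as zero with probability at most `2 ^ (-N * capBits n i l)`. A union bound then gives a
code without errors (`exists_generators`). Conversely, correctly decoded messages that share the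
conditioned components have distinct outputs in one coset, so they can be counted
(`SplitCode.card_correct_le`).

Arbitrary codes: a receiver that decodes its own message can subtract its own signal and is left
with the common signal of the other user, whether or not the code was designed for this. By Fano's
inequality, the entropy rates `H(common)` and `H(signal) - H(common)` of a good code therefore
nearly satisfy all ten constraints (`Code.rateSums_le`), while `H(signal)` is nearly the message
rate (`Code.logb_le`). Compactness turns these approximate splits into an exact one, and random
linear codes achieve it. -/

namespace DetIC

/-! ### Entropy of finite random variables. -/

section EntropyLemmas

variable {Ω α β γ : Type} [Fintype Ω]
  [Fintype α] [DecidableEq α] [Fintype β] [DecidableEq β] [Fintype γ] [DecidableEq γ]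

/-- The law of `X` under the mass function `p`. -/
noncomputable def law (p : Ω → ℝ) (X : Ω → α) (a : α) : ℝ := ∑ ω with X ω = a, p ω

theorem sum_mul_comp (p : Ω → ℝ) (X : Ω → α) (f : α → ℝ) :
    ∑ ω, p ω * f (X ω) = ∑ a, law p X a * f a := by
  rw [← Finset.sum_fiberwise Finset.univ X]
  refine Finset.sum_congr rfl fun a _ => ?_
  rw [law, Finset.sum_mul]
  refine Finset.sum_congr rfl fun ω hω => ?_
  rw [(Finset.mem_filter.1 hω).2]

theorem sum_law (p : Ω → ℝ) (X : Ω → α) : ∑ a, law p X a = ∑ ω, p ω := by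
  simpa using (sum_mul_comp p X fun _ => 1).symm

theorem law_nonneg {Ω α : Type} [Fintype Ω] [DecidableEq α] {p : Ω → ℝ}
    (hp : ∀ ω, 0 ≤ p ω) (X : Ω → α) (a : α) : 0 ≤ law p X a :=
  Finset.sum_nonneg fun ω _ => hp ω

theorem le_law {Ω α : Type} [Fintype Ω] [DecidableEq α] {p : Ω → ℝ}
    (hp : ∀ ω, 0 ≤ p ω) (X : Ω → α) (ω : Ω) : p ω ≤ law p X (X ω) :=
  Finset.single_le_sum (f := p) (fun ω _ => hp ω) (by simp)

theorem entropy_eq_sum (p : Ω → ℝ) (X : Ω → α) :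
    entropy p X = (∑ ω, p ω * -Real.log (law p X (X ω))) / Real.log 2 := by
  rw [sum_mul_comp p X fun a => -Real.log (law p X a), entropy]
  congr 1
  refine Finset.sum_congr rfl fun a _ => ?_
  rw [Real.negMulLog, law]
  ring

/-- Entropy depends only on the partition that the random variable induces. -/
theorem entropy_congr (p : Ω → ℝ) {X : Ω → α} {Y : Ω → β}
    (h : ∀ ω ω', X ω = X ω' ↔ Y ω = Y ω') : entropy p X = entropy p Y := by
  rw [entropy_eq_sum, entropy_eq_sum]
  congr 1
  refine Finset.sum_congr rfl fun ω _ => ?_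
  simp only [law, h]

theorem condEntropy_eq_sum (p : Ω → ℝ) (X : Ω → α) (Z : Ω → γ) :
    condEntropy p X Z = (∑ ω, p ω * (Real.log (law p Z (Z ω)) -
      Real.log (law p (fun ω => (X ω, Z ω)) (X ω, Z ω)))) / Real.log 2 := by
  rw [condEntropy, entropy_eq_sum, entropy_eq_sum, ← sub_div, ← Finset.sum_sub_distrib]
  congr 1
  refine Finset.sum_congr rfl fun ω _ => ?_
  ring

/-- Gibbs' inequality: the conditional entropy is at most the expected code length of any
conditional subprobability weight. -/
theorem condEntropy_le_of_weight {p : Ω → ℝ} (hp : p ∈ stdSimplex ℝ Ω) (X : Ω → α) (Z : Ω → γ)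
    (w : α → γ → ℝ) (hw : ∀ a z, 0 ≤ w a z) (hpos : ∀ ω, 0 < w (X ω) (Z ω))
    (hsum : ∀ z, ∑ a, w a z ≤ 1) :
    condEntropy p X Z ≤ ∑ ω, p ω * -Real.logb 2 (w (X ω) (Z ω)) := by
  obtain ⟨hp0, hp1⟩ := hp
  have hlog : 0 < Real.log 2 := Real.log_pos one_lt_two
  rw [condEntropy_eq_sum, div_le_iff₀ hlog, Finset.sum_mul]
  set P : α × γ → ℝ := law p (fun ω => (X ω, Z ω))
  set PZ : γ → ℝ := law p Z
  have hterm : ∀ ω, p ω * (Real.log (PZ (Z ω)) - Real.log (P (X ω, Z ω))) ≤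
      p ω * -Real.logb 2 (w (X ω) (Z ω)) * Real.log 2 +
        (p ω * (w (X ω) (Z ω) * PZ (Z ω) / P (X ω, Z ω)) - p ω) := by
    intro ω
    rcases (hp0 ω).eq_or_lt with h0 | h0
    · simp [← h0]
    · have hP : 0 < P (X ω, Z ω) := h0.trans_le (le_law hp0 (fun ω => (X ω, Z ω)) ω)
      have hZ : 0 < PZ (Z ω) := h0.trans_le (le_law hp0 Z ω)
      -- Gibbs: `log t ≤ t - 1` at the ratio of the weighted law `w * PZ` to the true joint law `P`.
      have hl := Real.log_le_sub_one_of_pos (div_pos (mul_pos (hpos ω) hZ) hP)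
      rw [Real.log_div (mul_pos (hpos ω) hZ).ne' hP.ne',
        Real.log_mul (hpos ω).ne' hZ.ne'] at hl
      have hb : Real.logb 2 (w (X ω) (Z ω)) * Real.log 2 = Real.log (w (X ω) (Z ω)) := by
        rw [Real.logb, div_mul_cancel₀ _ hlog.ne']
      have := mul_le_mul_of_nonneg_left hl h0.le
      linear_combination this + p ω * hb
  refine (Finset.sum_le_sum fun ω _ => hterm ω).trans ?_
  rw [Finset.sum_add_distrib, Finset.sum_sub_distrib, hp1,
    sum_mul_comp p (fun ω => (X ω, Z ω)) fun a => w a.1 a.2 * PZ a.2 / P a]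
  have : ∑ a, P a * (w a.1 a.2 * PZ a.2 / P a) ≤ 1 := by
    calc ∑ a, P a * (w a.1 a.2 * PZ a.2 / P a) ≤ ∑ a : α × γ, w a.1 a.2 * PZ a.2 := by
          refine Finset.sum_le_sum fun a _ => ?_
          rcases (law_nonneg hp0 (fun ω => (X ω, Z ω)) a).eq_or_lt with h0 | h0
          · have : P a = 0 := h0.symm
            rw [this, zero_mul]
            exact mul_nonneg (hw _ _) (law_nonneg hp0 _ _)
          · rw [mul_div_cancel₀ _ (show P a ≠ 0 from h0.ne')]
      _ = ∑ z, (∑ a, w a z) * PZ z := by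
          rw [Fintype.sum_prod_type_right]
          simp only [Finset.sum_mul]
      _ ≤ ∑ z, 1 * PZ z :=
          Finset.sum_le_sum fun z _ => mul_le_mul_of_nonneg_right (hsum z) (law_nonneg hp0 _ _)
      _ = 1 := by simp only [one_mul]; rw [sum_law, hp1]
  linarith

/-- Gibbs' inequality for the weight `2 ^ (-d)` on all values compatible with `z`; the counting
hypothesis makes it a subprobability. -/
theorem condEntropy_le_of_card {p : Ω → ℝ} (hp : p ∈ stdSimplex ℝ Ω) (X : Ω → α) (Z : Ω → γ)
    (d : ℕ) (h : ∀ S : Finset α, ∀ z, (∀ a ∈ S, ∃ ω, X ω = a ∧ Z ω = z) → S.card ≤ 2 ^ d) :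
    condEntropy p X Z ≤ d := by
  classical
  have h2 : (0 : ℝ) < (2 ^ d)⁻¹ := by positivity
  refine (condEntropy_le_of_weight hp X Z
    (fun a z => if ∃ ω, X ω = a ∧ Z ω = z then (2 ^ d)⁻¹ else 0) ?_ ?_ ?_).trans ?_
  · intro a z
    split_ifs
    exacts [h2.le, le_rfl]
  · intro ω
    rw [if_pos ⟨ω, rfl, rfl⟩]
    exact h2
  · intro z
    rw [← Finset.sum_filter, Finset.sum_const, nsmul_eq_mul, ← div_eq_mul_inv,
      div_le_one (by positivity)]
    exact_mod_cast h _ z fun a ha => (Finset.mem_filter.1 ha).2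
  · have : ∀ ω, p ω * -Real.logb 2 (if ∃ ω', X ω' = X ω ∧ Z ω' = Z ω then (2 ^ d)⁻¹ else 0) =
        p ω * d := by
      intro ω
      rw [if_pos ⟨ω, rfl, rfl⟩, Real.logb_inv, neg_neg, Real.logb_pow, Real.logb_self_eq_one
        one_lt_two, mul_one]
    simp only [this]
    rw [← Finset.sum_mul, hp.2, one_mul]

/-- If `Y` is determined by `X` and `Z`, then `I(X ; Y | Z) = H(Y | Z)`. -/
theorem condMutualInfo_eq_condEntropy (p : Ω → ℝ) {X : Ω → α} {Y : Ω → β} {Z : Ω → γ}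
    (h : ∀ ω ω', X ω = X ω' → Z ω = Z ω' → Y ω = Y ω') :
    condMutualInfo p X Y Z = condEntropy p Y Z := by
  have : entropy p (fun ω => (X ω, (Y ω, Z ω))) = entropy p (fun ω => (X ω, Z ω)) :=
    entropy_congr p fun ω ω' => by
      simp only [Prod.mk.injEq]
      exact ⟨fun ⟨h1, _, h3⟩ => ⟨h1, h3⟩, fun ⟨h1, h3⟩ => ⟨h1, h ω ω' h1 h3, h3⟩⟩
  rw [condMutualInfo, condEntropy, condEntropy, condEntropy, this]
  ring

/-- For a uniform law, the conditional entropy is computed from the sizes of the fibres. -/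
theorem condEntropy_uniform [Nonempty Ω] {p : Ω → ℝ} (hp : ∀ ω, p ω = (Fintype.card Ω : ℝ)⁻¹)
    (X : Ω → α) (Z : Ω → γ) (d : ℕ)
    (h : ∀ ω₀, (Finset.univ.filter fun ω => Z ω = Z ω₀).card =
      2 ^ d * (Finset.univ.filter fun ω => X ω = X ω₀ ∧ Z ω = Z ω₀).card) :
    condEntropy p X Z = d := by
  have hc : (0 : ℝ) < (Fintype.card Ω : ℝ)⁻¹ := by
    have := Fintype.card_pos (α := Ω)
    positivity
  have hlog : 0 < Real.log 2 := Real.log_pos one_lt_two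
  rw [condEntropy_eq_sum]
  have : ∀ ω, p ω * (Real.log (law p Z (Z ω)) -
      Real.log (law p (fun ω => (X ω, Z ω)) (X ω, Z ω))) = p ω * (d * Real.log 2) := by
    intro ω
    congr 1
    have hpos : 0 < (Finset.univ.filter fun ω' => X ω' = X ω ∧ Z ω' = Z ω).card :=
      Finset.card_pos.2 ⟨ω, by simp⟩
    have h1 : law p Z (Z ω) = 2 ^ d * law p (fun ω => (X ω, Z ω)) (X ω, Z ω) := by
      simp only [law, hp, Finset.sum_const, nsmul_eq_mul, Prod.mk.injEq, h ω]
      push_cast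
      ring
    have h2 : 0 < law p (fun ω => (X ω, Z ω)) (X ω, Z ω) := by
      simp only [law, hp, Finset.sum_const, nsmul_eq_mul, Prod.mk.injEq]
      have : (0 : ℝ) < (Finset.univ.filter fun ω' => X ω' = X ω ∧ Z ω' = Z ω).card := by
        exact_mod_cast hpos
      positivity
    rw [h1, Real.log_mul (by positivity) h2.ne', Real.log_pow]
    ring
  simp only [this]
  rw [← Finset.sum_mul, div_eq_iff hlog.ne']
  simp [hp]

/-- The entropy of an injective image of a uniform variable. -/
theorem entropy_uniform_injective {p : Ω → ℝ} (hp : ∀ ω, p ω = (Fintype.card Ω : ℝ)⁻¹)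
    {X : Ω → α} (hX : Function.Injective X) :
    entropy p X = Real.logb 2 (Fintype.card Ω) := by
  rw [entropy_eq_sum]
  have : ∀ ω, law p X (X ω) = (Fintype.card Ω : ℝ)⁻¹ := by
    intro ω
    have : (Finset.univ.filter fun ω' => X ω' = X ω) = {ω} := by
      ext ω'
      simp [hX.eq_iff]
    rw [law, this, Finset.sum_singleton, hp]
  simp only [this, Real.log_inv, neg_neg]
  simp only [hp]
  rcases isEmpty_or_nonempty Ω with h | h
  · simp
  · have : (Fintype.card Ω : ℝ) ≠ 0 := by exact_mod_cast Fintype.card_ne_zero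
    rw [Finset.sum_const, Finset.card_univ, nsmul_eq_mul, mul_inv_cancel_left₀ this, Real.logb]

/-- A function of a random variable has smaller entropy. -/
theorem entropy_le_of_factors {p : Ω → ℝ} (hp : ∀ ω, 0 ≤ p ω) {X : Ω → α} {Z : Ω → γ}
    (h : ∀ ω ω', X ω = X ω' → Z ω = Z ω') : entropy p Z ≤ entropy p X := by
  rw [entropy_eq_sum, entropy_eq_sum]
  refine div_le_div_of_nonneg_right (Finset.sum_le_sum fun ω _ => ?_) (Real.log_pos one_lt_two).le
  rcases (hp ω).eq_or_lt with h0 | h0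
  · simp [← h0]
  · refine mul_le_mul_of_nonneg_left (neg_le_neg (Real.log_le_log (h0.trans_le (le_law hp X ω))
      (Finset.sum_le_sum_of_subset_of_nonneg ?_ fun ω' _ _ => hp ω'))) h0.le
    intro ω' hω'
    simp only [Finset.mem_filter, Finset.mem_univ, true_and] at hω' ⊢
    exact h _ _ hω'

theorem condEntropy_eq_sub (p : Ω → ℝ) {X : Ω → α} {Z : Ω → γ} {V : Ω → β}
    (h : ∀ ω ω', X ω = X ω' ∧ Z ω = Z ω' ↔ V ω = V ω') :
    condEntropy p X Z = entropy p V - entropy p Z := by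
  rw [condEntropy, entropy_congr (Y := V) p fun ω ω' => by rw [Prod.mk.injEq, h]]

theorem entropy_const {p : Ω → ℝ} (hp : ∑ ω, p ω = 1) (c : α) :
    entropy p (fun _ => c) = 0 := by
  rw [entropy_eq_sum]
  simp [law, hp]

theorem entropy_nonneg {p : Ω → ℝ} (hp : p ∈ stdSimplex ℝ Ω) (X : Ω → α) : 0 ≤ entropy p X := by
  rw [← entropy_const hp.2 ()]
  exact entropy_le_of_factors hp.1 fun _ _ _ => rfl

/-- Entropy of a pair of independent variables. -/
theorem entropy_pair {Ω₁ Ω₂ : Type} [Fintype Ω₁] [Fintype Ω₂] (e : Ω ≃ Ω₁ × Ω₂)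
    {p : Ω → ℝ} {p₁ : Ω₁ → ℝ} {p₂ : Ω₂ → ℝ} (hp : ∀ ω, p ω = p₁ (e ω).1 * p₂ (e ω).2)
    (h₁ : p₁ ∈ stdSimplex ℝ Ω₁) (h₂ : p₂ ∈ stdSimplex ℝ Ω₂) (f : Ω₁ → α) (g : Ω₂ → β) :
    entropy p (fun ω => (f (e ω).1, g (e ω).2)) = entropy p₁ f + entropy p₂ g := by
  have hlaw : ∀ a b, law p (fun ω => (f (e ω).1, g (e ω).2)) (a, b) = law p₁ f a * law p₂ g b := by
    intro a b
    simp only [law, Finset.sum_filter, Prod.mk.injEq]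
    rw [Finset.sum_mul_sum, ← Finset.sum_product', Finset.univ_product_univ,
      ← e.sum_comp]
    refine Finset.sum_congr rfl fun ω _ => ?_
    rw [hp ω]
    by_cases h1 : f (e ω).1 = a <;> by_cases h2 : g (e ω).2 = b <;> simp [h1, h2]
  simp only [entropy_eq_sum, hlaw]
  rw [← add_div]
  congr 1
  have step : ∀ x : Ω₁ × Ω₂, p₁ x.1 * p₂ x.2 * -Real.log (law p₁ f (f x.1) * law p₂ g (g x.2)) =
      p₁ x.1 * -Real.log (law p₁ f (f x.1)) * p₂ x.2 +
        p₁ x.1 * (p₂ x.2 * -Real.log (law p₂ g (g x.2))) := by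
    intro x
    rcases (h₁.1 x.1).eq_or_lt with a | a
    · simp [← a]
    rcases (h₂.1 x.2).eq_or_lt with b | b
    · simp [← b]
    rw [Real.log_mul (a.trans_le (le_law h₁.1 f _)).ne' (b.trans_le (le_law h₂.1 g _)).ne']
    ring
  calc _ = ∑ x : Ω₁ × Ω₂, p₁ x.1 * p₂ x.2 *
        -Real.log (law p₁ f (f x.1) * law p₂ g (g x.2)) := by
        rw [← e.sum_comp]
        exact Finset.sum_congr rfl fun ω _ => by rw [hp ω]
    _ = _ := by
        simp only [step]
        rw [Finset.sum_add_distrib, Fintype.sum_prod_type, Fintype.sum_prod_type]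
        simp only [← Finset.mul_sum, ← Finset.sum_mul, h₁.2, h₂.2, mul_one, one_mul]

end EntropyLemmas

/-! ### The channel as a linear map over `𝔽₂` and its images. -/

@[simp] theorem other_zero : other 0 = 1 := rfl

@[simp] theorem other_one : other 1 = 0 := rfl

theorem other_other (i : Fin 2) : other (other i) = i := by fin_cases i <;> rfl

theorem other_ne (i : Fin 2) : other i ≠ i := by fin_cases i <;> decide

theorem eq_or_eq_other (i j : Fin 2) : j = i ∨ j = other i := by
  fin_cases i <;> fin_cases j <;> decide

theorem forall_user {P : Fin 2 → Prop} (i : Fin 2) : (∀ j, P j) ↔ P i ∧ P (other i) := by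
  refine ⟨fun h => ⟨h _, h _⟩, fun h j => ?_⟩
  rcases eq_or_eq_other i j with rfl | rfl
  exacts [h.1, h.2]

theorem sum_user {M : Type*} [AddCommMonoid M] (f : Fin 2 → M) (i : Fin 2) :
    ∑ j, f j = f i + f (other i) := by
  fin_cases i
  · exact Fin.sum_univ_two f
  · exact (Fin.sum_univ_two f).trans (add_comm _ _)

theorem gain_le_levels (n : Fin 2 → Fin 2 → ℕ) (i j : Fin 2) : n i j ≤ levels n := by
  fin_cases i <;> fin_cases j <;> simp [levels]

/-- The number of bits in the single-letter constraint `l` of receiver `i`. -/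
def capBits (n : Fin 2 → Fin 2 → ℕ) (i : Fin 2) : Fin 5 → ℕ :=
  ![max (n i i) (n i (other i)), n i i, n i (other i),
    max (n i (other i)) (n i i - n (other i) i), n i i - n (other i) i]

theorem capBits_le_levels (n : Fin 2 → Fin 2 → ℕ) (i : Fin 2) (l : Fin 5) :
    capBits n i l ≤ levels n := by
  have h1 := gain_le_levels n i i
  have h2 := gain_le_levels n i (other i)
  fin_cases l <;> simp [capBits] <;> omega

/-- The channel from the signals of both users to the output of receiver `i`, as a linear map. -/
def channel (n : Fin 2 → Fin 2 → ℕ) (i : Fin 2) :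
    (∀ j, Signal n j) →ₗ[ZMod 2] Bits (levels n) where
  toFun := outputOf n i
  map_add' x y := by
    funext k
    simp only [outputOf, output, Finset.sum_apply, Pi.add_apply, ← Finset.sum_add_distrib]
    refine Finset.sum_congr rfl fun j _ => ?_
    simp only [shiftDown, merge, Prod.fst_add, Prod.snd_add, Pi.add_apply]
    split_ifs <;> simp
  map_smul' c x := by
    funext k
    simp only [outputOf, output, Finset.sum_apply, Pi.smul_apply, Finset.smul_sum,
      RingHom.id_apply]
    refine Finset.sum_congr rfl fun j _ => ?_
    simp only [shiftDown, merge, Prod.smul_fst, Prod.smul_snd, Pi.smul_apply]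
    split_ifs <;> simp

/-- The signals whose component conditioned on in constraint `l` of receiver `i` is zero. -/
def freeSignals (n : Fin 2 → Fin 2 → ℕ) (i : Fin 2) (l : Fin 5) :
    Submodule (ZMod 2) (∀ j, Signal n j) where
  carrier := {x | (l ∈ ({2, 3, 4} : Finset (Fin 5)) → (x i).1 = 0) ∧ (l = 2 → (x i).2 = 0) ∧
    (l ∈ ({1, 4} : Finset (Fin 5)) → (x (other i)).1 = 0)}
  add_mem' := by
    rintro x y ⟨h1, h2, h3⟩ ⟨k1, k2, k3⟩
    refine ⟨fun h => ?_, fun h => ?_, fun h => ?_⟩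
    · simp [h1 h, k1 h]
    · simp [h2 h, k2 h]
    · simp [h3 h, k3 h]
  zero_mem' := ⟨fun _ => rfl, fun _ => rfl, fun _ => rfl⟩
  smul_mem' := by
    rintro c x ⟨h1, h2, h3⟩
    refine ⟨fun h => ?_, fun h => ?_, fun h => ?_⟩
    · simp [h1 h]
    · simp [h2 h]
    · simp [h3 h]

theorem mem_freeSignals {n : Fin 2 → Fin 2 → ℕ} {i : Fin 2} {l : Fin 5} {x : ∀ j, Signal n j} :
    x ∈ freeSignals n i l ↔
      (l ∈ ({2, 3, 4} : Finset (Fin 5)) → (x i).1 = 0) ∧ (l = 2 → (x i).2 = 0) ∧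
      (l ∈ ({1, 4} : Finset (Fin 5)) → (x (other i)).1 = 0) := Iff.rfl

/-- The bit vectors supported on the `d` least significant levels. -/
def lowBits (q d : ℕ) : Submodule (ZMod 2) (Bits q) where
  carrier := {z | ∀ k : Fin q, (k : ℕ) + d < q → z k = 0}
  add_mem' hx hy k hk := by simp [hx k hk, hy k hk]
  zero_mem' _ _ := rfl
  smul_mem' c x hx k hk := by simp [hx k hk]

theorem card_lowBits {q d : ℕ} (h : d ≤ q) : Nat.card (lowBits q d) = 2 ^ d := by
  have e : lowBits q d ≃ (Fin d → ZMod 2) :=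
    { toFun := fun z k => z.1 ⟨k + (q - d), by omega⟩
      invFun := fun v => ⟨fun k => if hk : q - d ≤ k then v ⟨k - (q - d), by omega⟩ else 0, by
        intro k hk
        dsimp only
        rw [dif_neg (by omega)]⟩
      left_inv := by
        rintro ⟨z, hz⟩
        ext k
        dsimp only
        split_ifs with hk
        · congr 2
          omega
        · rw [hz k (by omega)]
      right_inv := by
        intro v
        ext k
        dsimp only
        rw [dif_pos (by omega)]
        congr 3
        omega }
  rw [Nat.card_congr e]
  simp

theorem outputOf_apply (n : Fin 2 → Fin 2 → ℕ) (i : Fin 2) (x : ∀ j, Signal n j)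
    (k : Fin (levels n)) :
    outputOf n i x k = shiftDown (levels n - n i i) (merge n i (x i)) k +
      shiftDown (levels n - n i (other i)) (merge n (other i) (x (other i))) k := by
  rw [outputOf, output, sum_user _ i, Pi.add_apply]

/-- The signal of user `j` that agrees with a given channel input on the levels that matter. -/
def ofInput (n : Fin 2 → Fin 2 → ℕ) (j : Fin 2) (v : Bits (levels n)) : Signal n j :=
  (fun k => v ⟨k, k.2.trans_le (gain_le_levels n _ _)⟩,
   fun k => v ⟨k + n (other j) j, by have := gain_le_levels n j j; omega⟩)

theorem merge_ofInput (n : Fin 2 → Fin 2 → ℕ) (j : Fin 2) (v : Bits (levels n))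
    (k : Fin (levels n)) (hk : (k : ℕ) < n (other j) j ∨ (k : ℕ) < n j j) :
    merge n j (ofInput n j v) k = v k := by
  simp only [merge, ofInput]
  split_ifs with h1 h2
  · rfl
  · congr 1
    ext
    dsimp only
    omega
  · omega

theorem merge_ofInput_low (n : Fin 2 → Fin 2 → ℕ) (i j : Fin 2) (v : Bits (levels n))
    (k : Fin (levels n)) (hk : (k : ℕ) < n i j) :
    merge n j (ofInput n j v) k = v k := by
  refine merge_ofInput n j v k ?_
  rcases eq_or_eq_other j i with rfl | rfl
  exacts [Or.inr hk, Or.inl hk]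

/-- The inverse of `shiftDown d` on vectors whose `d` most significant bits vanish. -/
def shiftUp {q : ℕ} (d : ℕ) (z : Bits q) : Bits q := fun k =>
  if h : (k : ℕ) + d < q then z ⟨k + d, h⟩ else 0

theorem shiftDown_merge_ofInput {n : Fin 2 → Fin 2 → ℕ} {i j : Fin 2} {z : Bits (levels n)}
    (hz : z ∈ lowBits (levels n) (n i j)) :
    shiftDown (levels n - n i j)
      (merge n j (ofInput n j (shiftUp (levels n - n i j) z))) = z := by
  have hq := gain_le_levels n i j
  funext k
  simp only [shiftDown]
  split_ifs with h
  · rw [merge_ofInput_low n i j _ _ (by dsimp only; omega), shiftUp]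
    dsimp only
    rw [dif_pos (by omega)]
    congr 1
    ext
    dsimp only
    omega
  · exact (hz k (by omega)).symm

theorem shiftDown_zero {q : ℕ} (d : ℕ) : shiftDown d (0 : Bits q) = 0 := by
  funext k
  simp [shiftDown]

theorem merge_zero (n : Fin 2 → Fin 2 → ℕ) (j : Fin 2) : merge n j 0 = 0 := by
  funext k
  simp [merge]

theorem outputOf_single {n : Fin 2 → Fin 2 → ℕ} {i j : Fin 2} {z : Bits (levels n)}
    (hz : z ∈ lowBits (levels n) (n i j)) :
    outputOf n i (Pi.single j (ofInput n j (shiftUp (levels n - n i j) z))) = z := by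
  rw [outputOf, output, sum_user _ j, Pi.single_eq_same, Pi.single_eq_of_ne (other_ne j),
    merge_zero, shiftDown_zero, add_zero, shiftDown_merge_ofInput hz]

theorem lowBits_mono {q d e : ℕ} (h : d ≤ e) : lowBits q d ≤ lowBits q e :=
  fun _ hz k hk => hz k (by omega)

/-- An output confined to the levels where the private signal arrives needs no common signal:
undoing the shift leaves the top `n (other i) i` input levels zero. -/
theorem ofInput_shiftUp_fst_eq_zero {n : Fin 2 → Fin 2 → ℕ} {i : Fin 2} {z : Bits (levels n)}
    (hz : z ∈ lowBits (levels n) (n i i - n (other i) i)) :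
    (ofInput n i (shiftUp (levels n - n i i) z)).1 = 0 := by
  have hq := gain_le_levels n i i
  funext k
  simp only [ofInput, shiftUp, Pi.zero_apply]
  split_ifs with h
  · have := k.2
    exact hz _ (by dsimp only; omega)
  · rfl

/-- Every value of the `capBits n i l` lowest output levels is produced by signals that vanish on the
component conditioned on in constraint `l`. -/
theorem exists_outputOf_eq {n : Fin 2 → Fin 2 → ℕ} {i : Fin 2} {l : Fin 5} {z : Bits (levels n)}
    (hz : z ∈ lowBits (levels n) (capBits n i l)) :
    ∃ x ∈ freeSignals n i l, outputOf n i x = z := by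
  -- The spaces `lowBits` are nested, so the transmitter with the longer reach produces `z` alone
  -- while the other one is silent.
  have own : z ∈ lowBits (levels n) (n i i) → (l = 2 → False) →
      (l ∈ ({2, 3, 4} : Finset (Fin 5)) → z ∈ lowBits (levels n) (n i i - n (other i) i)) →
      ∃ x ∈ freeSignals n i l, outputOf n i x = z := by
    intro h h2 h'
    refine ⟨_, ⟨fun hl => ?_, fun hl => (h2 hl).elim, fun _ => ?_⟩, outputOf_single h⟩
    · rw [Pi.single_eq_same]
      exact ofInput_shiftUp_fst_eq_zero (h' hl)
    · rw [Pi.single_eq_of_ne (other_ne i)]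
      rfl
  have cross : z ∈ lowBits (levels n) (n i (other i)) → l ∉ ({1, 4} : Finset (Fin 5)) →
      ∃ x ∈ freeSignals n i l, outputOf n i x = z := by
    intro h h'
    refine ⟨_, ⟨fun _ => ?_, fun _ => ?_, fun hl => (h' hl).elim⟩, outputOf_single h⟩
    all_goals
      rw [Pi.single_eq_of_ne (other_ne i).symm]
      rfl
  fin_cases l
  · rcases le_total (n i i) (n i (other i)) with h | h
    · exact cross (lowBits_mono (by simp [capBits, h]) hz) (by decide)
    · exact own (lowBits_mono (by simp [capBits, h]) hz) (by decide) (fun h => absurd h (by decide))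
  · exact own hz (by decide) (fun h => absurd h (by decide))
  · exact cross hz (by decide)
  · rcases le_total (n i i - n (other i) i) (n i (other i)) with h | h
    · exact cross (lowBits_mono (by simp [capBits, h]) hz) (by decide)
    · have : z ∈ lowBits (levels n) (n i i - n (other i) i) :=
        lowBits_mono (by simp [capBits, h]) hz
      exact own (lowBits_mono (by omega) this) (by decide) (fun _ => this)
  · exact own (lowBits_mono (by simp [capBits]) hz) (by decide) (fun _ => hz)

/-- A component that is not forced to vanish reaches at most `n i i` (own signal), `n i i - n (other
i) i` (own private signal) or `n i (other i)` (cross signal) of the lowest levels; `capBits` is the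
largest that remains. -/
theorem outputOf_mem_lowBits {n : Fin 2 → Fin 2 → ℕ} {i : Fin 2} {l : Fin 5}
    {x : ∀ j, Signal n j} (hx : x ∈ freeSignals n i l) :
    outputOf n i x ∈ lowBits (levels n) (capBits n i l) := by
  obtain ⟨h1, h2, h3⟩ := hx
  have hii := gain_le_levels n i i
  have hij := gain_le_levels n i (other i)
  intro k hk
  have own : (n i i + k < levels n ∨ (l ∈ ({2, 3, 4} : Finset (Fin 5)) ∧
      (n i i - n (other i) i + k < levels n ∨ l = 2))) →
      shiftDown (levels n - n i i) (merge n i (x i)) k = 0 := by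
    intro h
    simp only [shiftDown, merge]
    split_ifs with g1 g2 g3
    · rw [h1 (by rcases h with h | h; omega; exact h.1)]
      rfl
    · rcases h with h | ⟨_, h | h⟩
      · omega
      · omega
      · rw [h2 h]
        rfl
    all_goals rfl
  have cross : (n i (other i) + k < levels n ∨ l ∈ ({1, 4} : Finset (Fin 5))) →
      shiftDown (levels n - n i (other i)) (merge n (other i) (x (other i))) k = 0 := by
    intro h
    have ho : n (other (other i)) (other i) = n i (other i) := by rw [other_other]
    simp only [shiftDown, merge]
    split_ifs with g1 g2 g3
    · rw [h3 (by rcases h with h | h; omega; exact h)]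
      rfl
    · rw [ho] at g2
      omega
    all_goals rfl
  rw [outputOf_apply, own, cross, add_zero]
  · fin_cases l <;> simp [capBits] at hk ⊢ <;> omega
  · fin_cases l <;> simp [capBits] at hk ⊢ <;> omega

/-- The private levels of the interferer lie below its top `n i (other i)` levels and are shifted
out at receiver `i`. -/
theorem outputOf_congr {n : Fin 2 → Fin 2 → ℕ} {i : Fin 2} {x x' : ∀ j, Signal n j}
    (h : x i = x' i) (h' : (x (other i)).1 = (x' (other i)).1) :
    outputOf n i x = outputOf n i x' := by
  have hij := gain_le_levels n i (other i)
  have ho : n (other (other i)) (other i) = n i (other i) := by rw [other_other]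
  funext k
  rw [outputOf_apply, outputOf_apply, h]
  congr 1
  simp only [shiftDown, merge, h']
  split_ifs with g1 g2 g3
  · rfl
  · rw [ho] at g2
    omega
  all_goals rfl

theorem outputOf_sub (n : Fin 2 → Fin 2 → ℕ) (i : Fin 2) (x x' : ∀ j, Signal n j) :
    outputOf n i (x - x') = outputOf n i x - outputOf n i x' := map_sub (channel n i) x x'

/-- Counting the elements of a set by blocks of vectors that pairwise differ only in the `d` lowest
bits. -/
theorem card_le_of_sub_mem_lowBits {ι : Type*} {q d N : ℕ} (hd : d ≤ q) (S : Finset ι)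
    (f : ι → Fin N → Bits q) (hf : Set.InjOn f S)
    (h : ∀ a ∈ S, ∀ b ∈ S, ∀ t, f a t - f b t ∈ lowBits q d) : S.card ≤ 2 ^ (N * d) := by
  rcases S.eq_empty_or_nonempty with rfl | ⟨b, hb⟩
  · simp
  have hcard : Nat.card (Fin N → lowBits q d) = 2 ^ (N * d) := by
    rw [Nat.card_fun, card_lowBits hd, Nat.card_eq_fintype_card, Fintype.card_fin, ← pow_mul,
      mul_comm]
  rw [← hcard, ← Fintype.card_coe, ← Nat.card_eq_fintype_card]
  refine Nat.card_le_card_of_injective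
    (fun a : S => fun t => (⟨f a t - f b t, h _ a.2 _ hb t⟩ : lowBits q d)) fun a a' haa => ?_
  refine Subtype.ext (hf a.2 a'.2 (funext fun t => ?_))
  exact sub_left_injective (congrArg Subtype.val (congrFun haa t))

/-! ### Single-letter mutual informations. -/

section Info

variable {n : Fin 2 → Fin 2 → ℕ} {Q : Type} [Fintype Q] [DecidableEq Q]

theorem InputLaw.pmf_mem {n : Fin 2 → Fin 2 → ℕ} {Q : Type} [Fintype Q] (p : InputLaw n Q) : p.pmf ∈ stdSimplex ℝ (Q × (∀ j, Signal n j)) := by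
  refine ⟨fun ω => mul_nonneg (p.timeShare_mem.1 _) (Finset.prod_nonneg fun i _ =>
    mul_nonneg ((p.common_mem i _).1 _) ((p.priv_mem i _ _).1 _)), ?_⟩
  rw [Fintype.sum_prod_type, ← p.timeShare_mem.2]
  refine Finset.sum_congr rfl fun q _ => ?_
  simp only [InputLaw.pmf]
  rw [← Finset.mul_sum]
  have := Finset.prod_univ_sum (fun i : Fin 2 => (Finset.univ : Finset (Signal n i)))
    (fun i s => p.common i q s.1 * p.priv i q s.1 s.2)
  rw [Fintype.piFinset_univ] at this
  rw [← this, Finset.prod_eq_one, mul_one]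
  intro i _
  rw [Fintype.sum_prod_type, ← (p.common_mem i q).2]
  refine Finset.sum_congr rfl fun c _ => ?_
  dsimp only
  rw [← Finset.mul_sum, (p.priv_mem i q c).2, mul_one]

/-- Each of the five mutual informations is `H(y_i | Z)`, where `Z` consists of the time-sharing
variable and the signal components conditioned on. -/
theorem InputLaw.info_induction (p : InputLaw n Q) (i : Fin 2) (l : Fin 5) (P : ℝ → Prop)
    (h : ∀ (γ : Type) [Fintype γ] [DecidableEq γ] (Z : Q × (∀ j, Signal n j) → γ),
      (∀ ω ω', Z ω = Z ω' ↔ ω.2 - ω'.2 ∈ freeSignals n i l ∧ ω.1 = ω'.1) →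
      P (condEntropy p.pmf (fun ω => outputOf n i ω.2) Z)) : P (p.info i l) := by
  fin_cases l <;> simp only [InputLaw.info]
  all_goals
    change P (condMutualInfo _ _ _ _)
    rw [condMutualInfo_eq_condEntropy]
    · apply h
      intro ω ω'
      simp [mem_freeSignals, sub_eq_zero, and_assoc, and_left_comm, and_comm]
    · intro ω ω' h1 h2
      simp only [Prod.mk.injEq] at h1 h2
      refine outputOf_congr (Prod.ext ?_ ?_) ?_ <;> tauto

/-- Two outputs compatible with the same value of `Z` differ by the output of a free signal, so at
most `2 ^ capBits n i l` outputs are compatible with it. -/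
theorem InputLaw.info_le (p : InputLaw n Q) (i : Fin 2) (l : Fin 5) :
    p.info i l ≤ capBits n i l := by
  apply p.info_induction i l (· ≤ (capBits n i l : ℝ))
  intro γ _ _ Z hZ
  refine condEntropy_le_of_card p.pmf_mem _ _ _ fun S z hS => ?_
  have := card_le_of_sub_mem_lowBits (N := 1) (capBits_le_levels n i l) S (fun a _ => a)
    (fun a _ b _ hab => congrFun hab 0) fun a ha b hb _ => by
      obtain ⟨ω, rfl, hω⟩ := hS a ha
      obtain ⟨ω', rfl, hω'⟩ := hS b hb
      rw [← outputOf_sub]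
      exact outputOf_mem_lowBits ((hZ ω ω').1 (hω.trans hω'.symm)).1
  simpa using this

end Info

/-- Rank-nullity as a count: the image of the restricted channel is `lowBits`. -/
theorem card_freeSignals (n : Fin 2 → Fin 2 → ℕ) (i : Fin 2) (l : Fin 5) :
    Nat.card (freeSignals n i l) = 2 ^ capBits n i l *
      Nat.card ((channel n i).domRestrict (freeSignals n i l)).ker := by
  set f := (channel n i).domRestrict (freeSignals n i l)
  have h1 : f.range = lowBits (levels n) (capBits n i l) := by
    ext z
    constructor
    · rintro ⟨x, rfl⟩
      exact outputOf_mem_lowBits x.2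
    · intro hz
      obtain ⟨x, hx, rfl⟩ := exists_outputOf_eq hz
      exact ⟨⟨x, hx⟩, rfl⟩
  rw [Submodule.card_eq_card_quotient_mul_card f.ker, Nat.card_congr f.quotKerEquivRange.toEquiv,
    h1, card_lowBits (capBits_le_levels n i l), mul_comm]

theorem uniformLaw_pmf (n : Fin 2 → Fin 2 → ℕ) (ω : Fin 1 × (∀ j, Signal n j)) :
    (uniformLaw n).pmf ω = (Fintype.card (Fin 1 × (∀ j, Signal n j)) : ℝ)⁻¹ := by
  simp only [InputLaw.pmf, uniformLaw, Fintype.card_prod, Fintype.card_pi, Fin.prod_univ_two]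
  push_cast
  simp only [mul_inv]

theorem uniformLaw_info (n : Fin 2 → Fin 2 → ℕ) (i : Fin 2) (l : Fin 5) :
    (uniformLaw n).info i l = capBits n i l := by
  apply (uniformLaw n).info_induction i l (· = (capBits n i l : ℝ))
  intro γ _ _ Z hZ
  refine condEntropy_uniform (uniformLaw_pmf n) _ _ _ fun ω₀ => ?_
  -- Translation by `ω₀` identifies the fibre of `Z` with the free signals, and below the joint
  -- fibre of output and `Z` with the kernel; the ratio of the sizes is `2 ^ capBits n i l` for
  -- every `ω₀`.
  have h1 : (Finset.univ.filter fun ω => Z ω = Z ω₀).card = Nat.card (freeSignals n i l) := by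
    rw [← Fintype.card_subtype, ← Nat.card_eq_fintype_card]
    exact Nat.card_congr
      { toFun := fun ω => ⟨ω.1.2 - ω₀.2, ((hZ _ _).1 ω.2).1⟩
        invFun := fun x => ⟨(ω₀.1, x.1 + ω₀.2), (hZ _ _).2 ⟨by simp, rfl⟩⟩
        left_inv := fun ω => Subtype.ext (Prod.ext (Subsingleton.elim _ _) (by simp))
        right_inv := fun x => Subtype.ext (by simp) }
  have h2 : (Finset.univ.filter fun ω : Fin 1 × (∀ j, Signal n j) =>
      outputOf n i ω.2 = outputOf n i ω₀.2 ∧ Z ω = Z ω₀).card =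
      Nat.card ((channel n i).domRestrict (freeSignals n i l)).ker := by
    rw [← Fintype.card_subtype, ← Nat.card_eq_fintype_card]
    exact Nat.card_congr
      { toFun := fun ω => ⟨⟨ω.1.2 - ω₀.2, ((hZ _ _).1 ω.2.2).1⟩, by
          change outputOf n i (ω.1.2 - ω₀.2) = 0
          rw [outputOf_sub, ω.2.1, sub_self]⟩
        invFun := fun x => ⟨(ω₀.1, x.1.1 + ω₀.2), by
          have hx : channel n i x.1.1 = 0 := x.2
          refine ⟨?_, (hZ _ _).2 ⟨by simp, rfl⟩⟩
          change channel n i _ = channel n i _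
          rw [map_add, hx, zero_add]⟩
        left_inv := fun ω => Subtype.ext (Prod.ext (Subsingleton.elim _ _) (by simp))
        right_inv := fun x => Subtype.ext (Subtype.ext (by simp)) }
  rw [h1, h2, card_freeSignals]

/-! ### The polyhedron of the ten bit counts. -/

/-- The explicit region in terms of the ten bit counts. -/
def InBitRegion (n : Fin 2 → Fin 2 → ℕ) (rc rp : Fin 2 → ℝ) : Prop :=
  (∀ i, 0 ≤ rc i ∧ 0 ≤ rp i) ∧ ∀ i l, rateSums rc rp i l ≤ capBits n i l

theorem inMACRegion_iff_inBitRegion (n : Fin 2 → Fin 2 → ℕ) (rc rp : Fin 2 → ℝ) :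
    InMACRegion n rc rp ↔ InBitRegion n rc rp := by
  constructor
  · rintro ⟨k, p, h0, h⟩
    exact ⟨h0, fun i l => (h i l).trans (p.info_le i l)⟩
  · rintro ⟨h0, h⟩
    exact ⟨1, uniformLaw n, h0, fun i l => (h i l).trans (uniformLaw_info n i l).ge⟩

theorem uniformLaw_inRegion_iff (n : Fin 2 → Fin 2 → ℕ) (rc rp : Fin 2 → ℝ) :
    (uniformLaw n).InRegion rc rp ↔ InBitRegion n rc rp := by
  simp only [InputLaw.InRegion, uniformLaw_info, InBitRegion]

theorem natCast_tsub_eq_posPart (a b : ℕ) : ((a - b : ℕ) : ℝ) = ((a : ℝ) - b)⁺ := by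
  rw [posPart_def]
  rcases le_total a b with h | h
  · have : (a : ℝ) ≤ b := by exact_mod_cast h
    simp [Nat.sub_eq_zero_of_le h, this]
  · have : (b : ℝ) ≤ a := by exact_mod_cast h
    simp [Nat.cast_sub h, this]

theorem max_eq_add_posPart_sub (a b : ℝ) : max a b = a + (b - a)⁺ := by
  rw [posPart_def]
  rcases le_total a b with h | h <;> simp [h]

theorem inExplicitRegion_iff_inBitRegion (n : Fin 2 → Fin 2 → ℕ) (rc rp : Fin 2 → ℝ) :
    InExplicitRegion n rc rp ↔ InBitRegion n rc rp := by
  have hf : ∀ (a b : Fin 5 → ℝ), (∀ l, a l ≤ b l) ↔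
      a 0 ≤ b 0 ∧ a 1 ≤ b 1 ∧ a 2 ≤ b 2 ∧ a 3 ≤ b 3 ∧ a 4 ≤ b 4 := by
    intro a b
    simp [Fin.forall_fin_succ]
  have e : InBitRegion n rc rp ↔ (∀ i, 0 ≤ rc i ∧ 0 ≤ rp i) ∧
      (rc 0 + rp 0 + rc 1 ≤ n 0 0 + ((n 0 1 : ℝ) - n 0 0)⁺ ∧ rc 0 + rp 0 ≤ n 0 0 ∧
        rc 1 ≤ n 0 1 ∧ rp 0 + rc 1 ≤ max (n 0 1 : ℝ) ((n 0 0 : ℝ) - n 1 0)⁺ ∧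
        rp 0 ≤ ((n 0 0 : ℝ) - n 1 0)⁺) ∧
      (rc 1 + rp 1 + rc 0 ≤ n 1 1 + ((n 1 0 : ℝ) - n 1 1)⁺ ∧ rc 1 + rp 1 ≤ n 1 1 ∧
        rc 0 ≤ n 1 0 ∧ rp 1 + rc 0 ≤ max (n 1 0 : ℝ) ((n 1 1 : ℝ) - n 0 1)⁺ ∧
        rp 1 ≤ ((n 1 1 : ℝ) - n 0 1)⁺) := by
    rw [InBitRegion]
    refine and_congr_right fun _ => ?_
    rw [Fin.forall_fin_two, hf, hf]
    simp [rateSums, capBits, natCast_tsub_eq_posPart, max_eq_add_posPart_sub (n 0 0 : ℝ),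
      max_eq_add_posPart_sub (n 1 1 : ℝ)]
  rw [e]
  simp only [InExplicitRegion, le_min_iff, ← min_add_add_left]
  constructor
  · rintro ⟨h0, h⟩
    exact ⟨h0, by tauto⟩
  -- The extra terms of the minima are sums of other constraints: `rc 1 ≤ n₂₂` follows from `rc 1 +
  -- rp 1 ≤ n₂₂`, and adding it to the bounds on `rc 0 + rp 0` and on `rp 0` gives the other two at
  -- receiver `0`; receiver `1` is symmetric.
  · rintro ⟨h0, ⟨a0, a1, a2, a3, a4⟩, b0, b1, b2, b3, b4⟩
    have := h0 0
    have := h0 1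
    refine ⟨h0, ⟨by linarith, by linarith⟩, a1, ⟨a2, by linarith⟩, ⟨by linarith, a3⟩, a4,
      ⟨by linarith, by linarith⟩, b1, ⟨b2, by linarith⟩, ⟨by linarith, b3⟩, b4⟩

/-! ### Random linear superposition codes. -/

/-- Generators of a linear superposition code of one user: a block of signals for every common
message bit and a block of private signals for every private message bit. -/
abbrev Generators (n : Fin 2 → Fin 2 → ℕ) (N : ℕ) (Kc Kp : Fin 2 → ℕ) (i : Fin 2) : Type :=
  (Fin (Kc i) → Fin N → Signal n i) × (Fin (Kp i) → Fin N → Priv n i)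

/-- Common and private message bits of user `i`. -/
abbrev Message (Kc Kp : Fin 2 → ℕ) (i : Fin 2) : Type := Bits (Kc i) × Bits (Kp i)

section Linear

variable {n : Fin 2 → Fin 2 → ℕ} {N : ℕ} {Kc Kp : Fin 2 → ℕ}

/-- The signal that a linear superposition code sends at time `t`. -/
def encode {i : Fin 2} (g : Generators n N Kc Kp i) (m : Message Kc Kp i) (t : Fin N) :
    Signal n i :=
  ∑ b, m.1 b • g.1 b t + ∑ b, m.2 b • ((0, g.2 b t) : Signal n i)

theorem encode_fst {i : Fin 2} (g : Generators n N Kc Kp i) (m : Message Kc Kp i) (t : Fin N) :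
    (encode g m t).1 = ∑ b, m.1 b • (g.1 b t).1 := by
  simp [encode, Prod.fst_sum]

theorem encode_sub {i : Fin 2} (g : Generators n N Kc Kp i) (m m' : Message Kc Kp i) (t : Fin N) :
    encode g (m - m') t = encode g m t - encode g m' t := by
  simp only [encode, Prod.fst_sub, Prod.snd_sub, Pi.sub_apply, sub_smul, Finset.sum_sub_distrib]
  abel

theorem encode_add_left {i : Fin 2} (g g' : Generators n N Kc Kp i) (m : Message Kc Kp i)
    (t : Fin N) : encode (g + g') m t = encode g m t + encode g' m t := by
  have : ∀ b, ((0, (g.2 + g'.2) b t) : Signal n i) = (0, g.2 b t) + (0, g'.2 b t) := by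
    intro b
    ext <;> simp
  simp only [encode, Prod.fst_add, Prod.snd_add, this]
  simp only [Pi.add_apply, smul_add, Finset.sum_add_distrib]
  abel

theorem encode_zero_left {i : Fin 2} (m : Message Kc Kp i) (t : Fin N) :
    encode (0 : Generators n N Kc Kp i) m t = 0 := by
  have : ((0, 0) : Signal n i) = 0 := rfl
  simp [encode, this]

theorem exists_eq_one {K : ℕ} {v : Bits K} (h : v ≠ 0) : ∃ b, v b = 1 := by
  obtain ⟨b, hb⟩ := Function.ne_iff.1 h
  refine ⟨b, ?_⟩
  have : ∀ c : ZMod 2, c ≠ 0 → c = 1 := by decide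
  exact this _ hb

/-- Some message bit equals `1`; its generator carries the whole block and all others are zero. -/
theorem exists_encode_eq {i : Fin 2} {m : Message Kc Kp i} (hm : m.1 ≠ 0)
    (v : Fin N → Signal n i) : ∃ g : Generators n N Kc Kp i, ∀ t, encode g m t = v t := by
  obtain ⟨b, hb⟩ := exists_eq_one hm
  refine ⟨(Pi.single b v, 0), fun t => ?_⟩
  have h0 : ((0, 0) : Signal n i) = 0 := rfl
  simp only [encode, Pi.zero_apply, h0, smul_zero, Finset.sum_const_zero, add_zero]
  rw [Finset.sum_eq_single b]
  · simp [hb]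
  · intro b' _ hne
    simp [Pi.single_eq_of_ne hne]
  · simp

theorem exists_encode_eq_private {i : Fin 2} {m : Message Kc Kp i} (hm : m.2 ≠ 0)
    (v : Fin N → Signal n i) (hv : ∀ t, (v t).1 = 0) :
    ∃ g : Generators n N Kc Kp i, ∀ t, encode g m t = v t := by
  obtain ⟨b, hb⟩ := exists_eq_one hm
  refine ⟨(0, Pi.single b fun t => (v t).2), fun t => ?_⟩
  have h0 : ((0, 0) : Signal n i) = 0 := rfl
  simp only [encode, Pi.zero_apply, smul_zero, Finset.sum_const_zero, zero_add]
  rw [Finset.sum_eq_single b]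
  · rw [hb, one_smul, Pi.single_eq_same]
    exact Prod.ext (hv t).symm rfl
  · intro b' _ hne
    simp [Pi.single_eq_of_ne hne, h0]
  · simp

/-- The block received by receiver `i`, as an additive function of the generators. -/
def receive (n : Fin 2 → Fin 2 → ℕ) (N : ℕ) {Kc Kp : Fin 2 → ℕ} (i : Fin 2)
    (m : ∀ j, Message Kc Kp j) :
    (∀ j, Generators n N Kc Kp j) →+ (Fin N → Bits (levels n)) where
  toFun g t := outputOf n i fun j => encode (g j) (m j) t
  map_zero' := by
    funext t
    simp only [Pi.zero_apply, encode_zero_left]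
    exact map_zero (channel n i)
  map_add' g g' := by
    funext t
    simp only [Pi.add_apply, encode_add_left]
    exact map_add (channel n i) (fun j => encode (g j) (m j) t) (fun j => encode (g' j) (m j) t)

theorem receive_apply (i : Fin 2) (m : ∀ j, Message Kc Kp j) (g : ∀ j, Generators n N Kc Kp j)
    (t : Fin N) : receive n N i m g t = outputOf n i fun j => encode (g j) (m j) t := rfl

theorem receive_sub (i : Fin 2) (m m' : ∀ j, Message Kc Kp j)
    (g : ∀ j, Generators n N Kc Kp j) :
    receive n N i (m - m') g = receive n N i m g - receive n N i m' g := by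
  funext t
  simp only [receive_apply, Pi.sub_apply, encode_sub]
  exact outputOf_sub n i (fun j => encode (g j) (m j) t) (fun j => encode (g j) (m' j) t)

/-- Message differences for which constraint `l` governs the confusion probability at receiver `i`.
The private message of the other user, which does not affect receiver `i`, is normalised to zero. -/
def Governs (i : Fin 2) (l : Fin 5) (m : ∀ j, Message Kc Kp j) : Prop :=
  (l ∈ ({0, 1} : Finset (Fin 5)) → (m i).1 ≠ 0) ∧
  (l ∈ ({2, 3, 4} : Finset (Fin 5)) → (m i).1 = 0) ∧
  (l = 2 → (m i).2 = 0) ∧ (l ∈ ({3, 4} : Finset (Fin 5)) → (m i).2 ≠ 0) ∧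
  (l ∈ ({1, 4} : Finset (Fin 5)) → (m (other i)).1 = 0) ∧
  (l ∈ ({0, 2, 3} : Finset (Fin 5)) → (m (other i)).1 ≠ 0) ∧ (m (other i)).2 = 0

theorem exists_governs {i : Fin 2} {m : ∀ j, Message Kc Kp j} (h2 : (m (other i)).2 = 0)
    (h : ¬ ((m i).1 = 0 ∧ (m i).2 = 0 ∧ (m (other i)).1 = 0)) : ∃ l, Governs i l m := by
  by_cases a : (m i).1 = 0 <;> by_cases b : (m i).2 = 0 <;> by_cases c : (m (other i)).1 = 0
  · exact absurd ⟨a, b, c⟩ h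
  · exact ⟨2, by simp [Governs, a, b, c, h2]⟩
  · exact ⟨4, by simp [Governs, a, b, c, h2]⟩
  · exact ⟨3, by simp [Governs, a, b, c, h2]⟩
  · exact ⟨1, by simp [Governs, a, c, h2]⟩
  · exact ⟨0, by simp [Governs, a, c, h2]⟩
  · exact ⟨1, by simp [Governs, a, c, h2]⟩
  · exact ⟨0, by simp [Governs, a, c, h2]⟩

/-- A nonzero common difference can be encoded to any signal block, a nonzero private one to any
block without common part. The zero pattern in `Governs` thus leaves exactly the freedom of
`freeSignals` that matters at receiver `i`. -/
theorem exists_receive_eq {i : Fin 2} {l : Fin 5} {m : ∀ j, Message Kc Kp j}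
    (hm : Governs i l m) {z : Fin N → Bits (levels n)}
    (hz : ∀ t, z t ∈ lowBits (levels n) (capBits n i l)) :
    ∃ g : ∀ j, Generators n N Kc Kp j, receive n N i m g = z := by
  choose x hx hxz using fun t => exists_outputOf_eq (hz t)
  obtain ⟨h1, h2, h3, h4, h5, h6, -⟩ := hm
  have own : ∃ g : Generators n N Kc Kp i, ∀ t, encode g (m i) t = x t i := by
    by_cases a : (m i).1 = 0
    · have hl : l ∈ ({2, 3, 4} : Finset (Fin 5)) := by
        by_contra hl
        refine h1 ?_ a
        revert hl
        fin_cases l <;> decide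
      have hx1 : ∀ t, (x t i).1 = 0 := fun t => (hx t).1 hl
      by_cases b : (m i).2 = 0
      · have hl2 : l = 2 := by
          by_contra hl2
          refine h4 ?_ b
          revert hl hl2
          fin_cases l <;> decide
        refine ⟨0, fun t => ?_⟩
        rw [encode_zero_left]
        exact (Prod.ext (hx1 t) ((hx t).2.1 hl2)).symm
      · exact exists_encode_eq_private b _ hx1
    · exact exists_encode_eq a _
  have cross : ∃ g : Generators n N Kc Kp (other i),
      ∀ t, (encode g (m (other i)) t).1 = (x t (other i)).1 := by
    by_cases c : (m (other i)).1 = 0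
    · have hl : l ∈ ({1, 4} : Finset (Fin 5)) := by
        by_contra hl
        refine h6 ?_ c
        revert hl
        fin_cases l <;> decide
      refine ⟨0, fun t => ?_⟩
      rw [encode_zero_left, (hx t).2.2 hl]
      rfl
    · obtain ⟨g, hg⟩ := exists_encode_eq c fun t => x t (other i)
      exact ⟨g, fun t => by rw [hg]⟩
  obtain ⟨g₁, hg₁⟩ := own
  obtain ⟨g₂, hg₂⟩ := cross
  have hne := (other_ne i).symm
  obtain ⟨g, rfl, rfl⟩ : ∃ g : ∀ j, Generators n N Kc Kp j, g i = g₁ ∧ g (other i) = g₂ :=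
    ⟨Function.update (Function.update 0 i g₁) (other i) g₂, by
      rw [Function.update_of_ne hne, Function.update_self], by rw [Function.update_self]⟩
  refine ⟨g, funext fun t => ?_⟩
  rw [receive_apply, ← hxz t]
  exact outputOf_congr (hg₁ t) (hg₂ t)

/-- Confusion probability of a random generator family. Translating the kernel of the additive map
`receive` by one preimage of each block of low vectors gives disjoint copies of the kernel. -/
theorem card_receive_eq_zero_mul_le [Fintype (∀ j, Generators n N Kc Kp j)] {i : Fin 2} {l : Fin 5}
    {m : ∀ j, Message Kc Kp j} (hm : Governs i l m) :
    (Finset.univ.filter fun g => receive n N i m g = 0).card * 2 ^ (N * capBits n i l) ≤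
      Fintype.card (∀ j, Generators n N Kc Kp j) := by
  have hcard : Nat.card (Fin N → lowBits (levels n) (capBits n i l)) = 2 ^ (N * capBits n i l) := by
    rw [Nat.card_fun, card_lowBits (capBits_le_levels n i l), Nat.card_eq_fintype_card,
      Fintype.card_fin, ← pow_mul, mul_comm]
  choose G hG using fun z : Fin N → lowBits (levels n) (capBits n i l) =>
    exists_receive_eq (Kc := Kc) (Kp := Kp) hm (z := fun t => (z t).1) fun t => (z t).2
  rw [← hcard, ← Fintype.card_subtype, ← Nat.card_eq_fintype_card, ← Nat.card_eq_fintype_card,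
    ← Nat.card_prod]
  refine Nat.card_le_card_of_injective (fun a => a.1.1 + G a.2) ?_
  rintro ⟨⟨g, hg⟩, z⟩ ⟨⟨g', hg'⟩, z'⟩ h
  dsimp only at h
  have hz : z = z' := by
    have := congrArg (receive n N i m) h
    rw [map_add, map_add, hg, hg', zero_add, zero_add, hG, hG] at this
    exact funext fun t => Subtype.ext (congrFun this t)
  subst hz
  simpa using h

/-- The numbers of message bits bounded by the five constraints of receiver `i`. -/
def bitSums (Kc Kp : Fin 2 → ℕ) (i : Fin 2) : Fin 5 → ℕ :=
  ![Kc i + Kp i + Kc (other i), Kc i + Kp i, Kc (other i), Kp i + Kc (other i), Kp i]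

/-- A governed difference is determined by the components that `Governs` does not force to vanish.
-/
theorem card_governs_le (i : Fin 2) (l : Fin 5)
    [DecidablePred fun m : ∀ j, Message Kc Kp j => Governs i l m] :
    (Finset.univ.filter fun m : ∀ j, Message Kc Kp j => Governs i l m).card ≤
      2 ^ bitSums Kc Kp i l := by
  have key : ∀ (τ : Type) [Fintype τ] (f : (∀ j, Message Kc Kp j) → τ),
      (∀ m m', Governs i l m → Governs i l m' → f m = f m' →
        (m i).1 = (m' i).1 ∧ (m i).2 = (m' i).2 ∧ (m (other i)).1 = (m' (other i)).1) →
      (Finset.univ.filter fun m : ∀ j, Message Kc Kp j => Governs i l m).card ≤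
        Fintype.card τ := by
    intro τ _ f hf
    refine Finset.card_le_card_of_injOn f (fun _ _ => Finset.mem_univ _) fun m hm m' hm' h => ?_
    have hm := (Finset.mem_filter.1 hm).2
    have hm' := (Finset.mem_filter.1 hm').2
    obtain ⟨h1, h2, h3⟩ := hf m m' hm hm' h
    refine funext ((forall_user (P := fun j => m j = m' j) i).2 ⟨Prod.ext h1 h2, Prod.ext h3 ?_⟩)
    rw [hm.2.2.2.2.2.2, hm'.2.2.2.2.2.2]
  fin_cases l
  · refine (key (Bits (Kc i) × Bits (Kp i) × Bits (Kc (other i)))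
      (fun m => ((m i).1, (m i).2, (m (other i)).1)) ?_).trans ?_
    · intro m m' _ _ h
      simpa using h
    · simp [bitSums, pow_add, mul_assoc]
  · refine (key (Bits (Kc i) × Bits (Kp i)) (fun m => ((m i).1, (m i).2)) ?_).trans ?_
    · intro m m' h1 h2 h
      simp only [Prod.mk.injEq] at h
      exact ⟨h.1, h.2, (h1.2.2.2.2.1 (by decide)).trans (h2.2.2.2.2.1 (by decide)).symm⟩
    · simp [bitSums, pow_add]
  · refine (key (Bits (Kc (other i))) (fun m => (m (other i)).1) ?_).trans ?_
    · intro m m' h1 h2 h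
      exact ⟨(h1.2.1 (by decide)).trans (h2.2.1 (by decide)).symm,
        (h1.2.2.1 rfl).trans (h2.2.2.1 rfl).symm, h⟩
    · simp [bitSums]
  · refine (key (Bits (Kp i) × Bits (Kc (other i))) (fun m => ((m i).2, (m (other i)).1)) ?_).trans
      ?_
    · intro m m' h1 h2 h
      simp only [Prod.mk.injEq] at h
      exact ⟨(h1.2.1 (by decide)).trans (h2.2.1 (by decide)).symm, h.1, h.2⟩
    · simp [bitSums, pow_add]
  · refine (key (Bits (Kp i)) (fun m => (m i).2) ?_).trans ?_
    · intro m m' h1 h2 h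
      exact ⟨(h1.2.1 (by decide)).trans (h2.2.1 (by decide)).symm, h,
        (h1.2.2.2.2.1 (by decide)).trans (h2.2.2.2.2.1 (by decide)).symm⟩
    · simp [bitSums]

/-- A constraint on no message bits governs no difference, so it needs no slack and may have
`capBits` equal to zero. -/
theorem bitSums_ne_zero {i : Fin 2} {l : Fin 5} {m : ∀ j, Message Kc Kp j}
    (hm : Governs i l m) : bitSums Kc Kp i l ≠ 0 := by
  have pos : ∀ {K : ℕ} {v : Bits K}, v ≠ 0 → K ≠ 0 := by
    rintro K v hv rfl
    exact hv (Subsingleton.elim _ _)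
  obtain ⟨h1, -, -, h4, -, h6, -⟩ := hm
  fin_cases l
  · have := pos (h1 (by decide))
    simp only [bitSums, Fin.isValue, Fin.zero_eta, Matrix.cons_val_zero]
    omega
  · have := pos (h1 (by decide))
    simp [bitSums]
    omega
  · exact pos (h6 (by decide))
  · have := pos (h4 (by decide))
    simp [bitSums]
    omega
  · exact pos (h4 (by decide))

/-- Random coding: some linear superposition code separates all messages that have to be
decoded. -/
theorem exists_generators (h : ∀ i l, bitSums Kc Kp i l = 0 ∨
      bitSums Kc Kp i l + 4 ≤ N * capBits n i l) :
    ∃ g : ∀ j, Generators n N Kc Kp j, ∀ i l m, Governs i l m → receive n N i m g ≠ 0 := by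
  classical
  by_contra! hcon
  set G := ∀ j, Generators n N Kc Kp j
  have hsub : (Finset.univ : Finset G) ⊆ Finset.univ.biUnion fun a : Fin 2 × Fin 5 =>
      (Finset.univ.filter fun m : ∀ j, Message Kc Kp j => Governs a.1 a.2 m).biUnion fun m =>
        Finset.univ.filter fun g => receive n N a.1 m g = 0 := by
    intro g _
    obtain ⟨i, l, m, hm, hg⟩ := hcon g
    simp only [Finset.mem_biUnion, Finset.mem_univ, Finset.mem_filter, true_and]
    exact ⟨(i, l), m, hm, hg⟩
  -- The four spare bits make the bad families of each constraint at most a sixteenth of all; there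
  -- are ten constraints, and 10 < 16.
  have hbound : ∀ a : Fin 2 × Fin 5,
      ((Finset.univ.filter fun m : ∀ j, Message Kc Kp j => Governs a.1 a.2 m).biUnion fun m =>
        Finset.univ.filter fun g : G => receive n N a.1 m g = 0).card * 16 ≤ Fintype.card G := by
    rintro ⟨i, l⟩
    dsimp only
    rcases h i l with h0 | h0
    · rw [Finset.filter_false_of_mem fun m _ hm => bitSums_ne_zero hm h0]
      simp
    · set A := Finset.univ.filter fun m : ∀ j, Message Kc Kp j => Governs i l m
      have hA : A.card ≤ 2 ^ bitSums Kc Kp i l := card_governs_le i l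
      have h2 : 0 < 2 ^ bitSums Kc Kp i l := by positivity
      refine le_of_mul_le_mul_right ?_ h2
      calc (A.biUnion fun m => Finset.univ.filter fun g : G => receive n N i m g = 0).card * 16 *
            2 ^ bitSums Kc Kp i l
          ≤ (∑ m ∈ A, (Finset.univ.filter fun g : G => receive n N i m g = 0).card) * 16 *
            2 ^ bitSums Kc Kp i l := by gcongr; exact Finset.card_biUnion_le
        _ = ∑ m ∈ A, (Finset.univ.filter fun g : G => receive n N i m g = 0).card *
            2 ^ (bitSums Kc Kp i l + 4) := by
          rw [← Finset.sum_mul, pow_add]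
          ring
        _ ≤ ∑ m ∈ A, Fintype.card G := by
          refine Finset.sum_le_sum fun m hm => ?_
          refine le_trans ?_ (card_receive_eq_zero_mul_le (Finset.mem_filter.1 hm).2)
          exact Nat.mul_le_mul_left _ (Nat.pow_le_pow_right two_pos h0)
        _ = A.card * Fintype.card G := by rw [Finset.sum_const, smul_eq_mul]
        _ ≤ Fintype.card G * 2 ^ bitSums Kc Kp i l := by
          rw [mul_comm]
          exact Nat.mul_le_mul_left _ hA
  have hG : 0 < Fintype.card G := Fintype.card_pos
  have h1 := (Finset.card_le_card hsub).trans Finset.card_biUnion_le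
  have h2 : (∑ a : Fin 2 × Fin 5,
      ((Finset.univ.filter fun m : ∀ j, Message Kc Kp j => Governs a.1 a.2 m).biUnion fun m =>
        Finset.univ.filter fun g : G => receive n N a.1 m g = 0).card) * 16 ≤
      10 * Fintype.card G := by
    rw [Finset.sum_mul]
    refine (Finset.sum_le_sum fun a _ => hbound a).trans ?_
    simp
  rw [Finset.card_univ] at h1
  omega

theorem exists_splitCode (h : ∀ i l, bitSums Kc Kp i l = 0 ∨
      bitSums Kc Kp i l + 4 ≤ N * capBits n i l) :
    ∃ C : SplitCode n N (fun i => 2 ^ Kc i) (fun i => 2 ^ Kp i),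
      ∀ i m, C.dec i (C.received i m) = ((m i).1, (m i).2, (m (other i)).1) := by
  classical
  obtain ⟨g, hg⟩ := exists_generators h
  have e : ∀ K : ℕ, Fin (2 ^ K) ≃ Bits K := fun K =>
    (Fintype.equivFinOfCardEq (by simp)).symm
  set msg : (∀ j, Fin (2 ^ Kc j) × Fin (2 ^ Kp j)) → ∀ j, Message Kc Kp j :=
    fun m j => (e _ (m j).1, e _ (m j).2)
  have hsep : ∀ i (m m' : ∀ j, Message Kc Kp j), receive n N i m g = receive n N i m' g →
      (m i).1 = (m' i).1 ∧ (m i).2 = (m' i).2 ∧ (m (other i)).1 = (m' (other i)).1 := by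
    intro i m m' hmm
    by_contra hne
    set u := m - m'
    have hu : receive n N i u g = 0 := by rw [receive_sub, hmm, sub_self]
    -- The interferer's private difference is erased, as `Governs` requires; receiver `i` does not
    -- see it.
    set v := Function.update u (other i) ((u (other i)).1, 0)
    have hvi : v i = u i := Function.update_of_ne (other_ne i).symm _ _
    have hvo : v (other i) = ((u (other i)).1, 0) := Function.update_self _ _ _
    have hv : receive n N i v g = 0 := by
      rw [← hu]
      funext t
      rw [receive_apply, receive_apply]
      refine outputOf_congr (by rw [hvi]) ?_
      rw [encode_fst, encode_fst, hvo]
    obtain ⟨l, hl⟩ := exists_governs (i := i) (m := v) (by rw [hvo]) (by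
      rw [hvi, hvo]
      simpa [u, sub_eq_zero] using hne)
    exact hg i l v hl hv
  let rcv : Fin 2 → (∀ j, Fin (2 ^ Kc j) × Fin (2 ^ Kp j)) → Fin N → Bits (levels n) :=
    fun i m => receive n N i (msg m) g
  obtain ⟨dec, hdec⟩ : ∃ dec : ∀ i, (Fin N → Bits (levels n)) →
      Fin (2 ^ Kc i) × Fin (2 ^ Kp i) × Fin (2 ^ Kc (other i)),
      ∀ i m, dec i (rcv i m) = ((m i).1, (m i).2, (m (other i)).1) := by
    refine ⟨fun i y => if hy : ∃ m, rcv i m = y then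
        ((hy.choose i).1, (hy.choose i).2, (hy.choose (other i)).1)
      else (⟨0, by positivity⟩, ⟨0, by positivity⟩, ⟨0, by positivity⟩), fun i m => ?_⟩
    have hy : ∃ m', rcv i m' = rcv i m := ⟨m, rfl⟩
    have := hsep i _ _ hy.choose_spec
    dsimp only
    rw [dif_pos hy]
    simp only [msg, EmbeddingLike.apply_eq_iff_eq] at this
    rw [this.1, this.2.1, this.2.2]
  -- The common part of a codeword ignores the private message, so `0` can stand in for it.
  let C : SplitCode n N (fun i => 2 ^ Kc i) (fun i => 2 ^ Kp i) :=
    { encC := fun i a t => (encode (g i) (e _ a, 0) t).1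
      encP := fun i a b t => (encode (g i) (e _ a, e _ b) t).2
      dec := dec }
  refine ⟨C, fun i m => ?_⟩
  have hr : C.received i m = rcv i m := by
    funext t
    refine outputOf_congr (x := fun j => (C.encC j (m j).1 t, C.encP j (m j).1 (m j).2 t))
      (x' := fun j => encode (g j) (msg m j) t) (Prod.ext ?_ rfl) ?_
    all_goals
      dsimp only [C, msg]
      rw [encode_fst, encode_fst]
  rw [hr]
  exact hdec i m

end Linear
-- Split codes: achievability and converse.
section Split

variable {n : Fin 2 → Fin 2 → ℕ} {N : ℕ} {Mc Mp : Fin 2 → ℕ}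

theorem denom_eq (Mc Mp : Fin 2 → ℕ) (i : Fin 2) : (Mc 0 : ℝ) * Mp 0 * Mc 1 * Mp 1 =
    Mc i * Mp i * (Mc (other i) * Mp (other i)) := by
  fin_cases i <;> simp <;> ring

theorem SplitCode.success_eq_one (C : SplitCode n N Mc Mp) {i : Fin 2}
    (h : ∀ m, C.dec i (C.received i m) = ((m i).1, (m i).2, (m (other i)).1))
    (hc : ∀ i, Mc i ≠ 0) (hp : ∀ i, Mp i ≠ 0) : C.success i = 1 := by
  rw [SplitCode.success, Finset.filter_true_of_mem fun m _ => h m, div_eq_one_iff_eq]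
  · simp [mul_assoc]
  · simp [hc, hp]

/-- The other receiver decodes this common message from an output that depends on it only through
the common signal. Injectivity makes the entropy of the common signal equal to the common rate. -/
theorem SplitCode.encC_injective (C : SplitCode n N Mc Mp)
    (h : ∀ i m, C.dec i (C.received i m) = ((m i).1, (m i).2, (m (other i)).1))
    (hc : ∀ i, Mc i ≠ 0) (hp : ∀ i, Mp i ≠ 0) (i : Fin 2) : Function.Injective (C.encC i) := by
  obtain ⟨j, rfl⟩ : ∃ j, i = other j := ⟨other i, (other_other i).symm⟩
  intro a a' haa
  let b : ∀ j, Fin (Mc j) × Fin (Mp j) := fun j =>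
    (⟨0, Nat.pos_of_ne_zero (hc j)⟩, ⟨0, Nat.pos_of_ne_zero (hp j)⟩)
  set m := Function.update b (other j) (a, (b (other j)).2)
  set m' := Function.update b (other j) (a', (b (other j)).2)
  have hm : m (other j) = (a, (b (other j)).2) := Function.update_self _ _ _
  have hm' : m' (other j) = (a', (b (other j)).2) := Function.update_self _ _ _
  have hj : m j = m' j :=
    (Function.update_of_ne (other_ne j).symm _ _).trans
      (Function.update_of_ne (other_ne j).symm _ _).symm
  have hr : C.received j m = C.received j m' := by
    funext t
    refine outputOf_congr (by rw [hj]) ?_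
    rw [hm, hm', haa]
  have h1 := h j m
  rw [hr, h j m', hm, hm'] at h1
  simp only [Prod.mk.injEq] at h1
  exact h1.2.2.symm

theorem SplitCode.commonEntropy_eq (C : SplitCode n N Mc Mp) {i : Fin 2}
    (h : Function.Injective (C.encC i)) : C.commonEntropy i = Real.logb 2 (Mc i) := by
  rw [SplitCode.commonEntropy, entropy_uniform_injective (by simp) h, Fintype.card_fin]

/-- Integer numbers of message bits just below a given rate. -/
theorem exists_bits {r ε : ℝ} (hr : 0 ≤ r) {N : ℕ} (hN : 4 ≤ N * (ε / 2)) :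
    ∃ K : ℕ, (K : ℝ) ≤ N * r ∧ (K = 0 ∨ (K : ℝ) + 4 ≤ N * r) ∧ N * (r - ε) < K := by
  have hN0 : (0 : ℝ) ≤ N := N.cast_nonneg
  -- Small rates are rounded to zero bits. Otherwise the rate is lowered by `ε / 2`, which frees `N
  -- * (ε / 2) ≥ 4` bits; the other half of `ε` absorbs the floor.
  rcases le_total (r - ε / 2) 0 with h | h
  · refine ⟨0, by simpa using mul_nonneg hN0 hr, Or.inl rfl, ?_⟩
    have := mul_le_mul_of_nonneg_left h hN0
    push_cast
    linarith
  · have h1 := Nat.floor_le (mul_nonneg hN0 h)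
    have h2 := Nat.lt_floor_add_one ((N : ℝ) * (r - ε / 2))
    exact ⟨⌊(N : ℝ) * (r - ε / 2)⌋₊, by linarith, Or.inr (by linarith), by linarith⟩

theorem splitAchievable_of_inBitRegion {rc rp : Fin 2 → ℝ} (h : InBitRegion n rc rp) :
    SplitAchievable n rc rp := by
  obtain ⟨h0, h⟩ := h
  -- `N ≥ 8 / ε` is the condition `N * (ε / 2) ≥ 4` of `exists_bits`; the added one keeps `N`
  -- positive.
  refine ⟨h0, fun ε hε μ hμ _ => ⟨⌈8 / ε⌉₊ + 1, fun N hN => ?_⟩⟩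
  have hN' : 8 / ε ≤ N := (Nat.le_ceil _).trans (by exact_mod_cast (by omega : ⌈8 / ε⌉₊ ≤ N))
  have hN4 : 4 ≤ N * (ε / 2) := by
    rw [div_le_iff₀ hε] at hN'
    linarith
  have hNpos : (0 : ℝ) < N := by
    exact_mod_cast (by omega : 0 < N)
  choose Kc hc1 hc2 hc3 using fun i => exists_bits (h0 i).1 hN4
  choose Kp hp1 hp2 hp3 using fun i => exists_bits (h0 i).2 hN4
  have hK : ∀ i l, bitSums Kc Kp i l = 0 ∨ bitSums Kc Kp i l + 4 ≤ N * capBits n i l := by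
    intro i l
    -- A single nonzero summand already supplies the four spare bits of the sum.
    have : bitSums Kc Kp i l = 0 ∨
        ((bitSums Kc Kp i l : ℕ) : ℝ) + 4 ≤ N * rateSums rc rp i l := by
      have a1 := hc1 i
      have a2 := hc1 (other i)
      have a3 := hp1 i
      rcases hc2 i with b1 | b1 <;> rcases hc2 (other i) with b2 | b2 <;>
        rcases hp2 i with b3 | b3 <;>
        fin_cases l <;>
        simp only [bitSums, rateSums, Fin.zero_eta, Fin.mk_one, Fin.reduceFinMk, Matrix.cons_val] <;>
        first
          | (left; omega)
          | (right; push_cast; linarith)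
    rcases this with h1 | h1
    · exact Or.inl h1
    · right
      have := h1.trans (mul_le_mul_of_nonneg_left (h i l) hNpos.le)
      exact_mod_cast this
  obtain ⟨C, hC⟩ := exists_splitCode hK
  have hlog : ∀ K : ℕ, Real.logb 2 ((2 ^ K : ℕ) : ℝ) = K := fun K => by
    rw [Nat.cast_pow, Nat.cast_ofNat, Real.logb_pow, Real.logb_self_eq_one one_lt_two, mul_one]
  have hpow : ∀ K : ℕ, 2 ^ K ≠ 0 := fun K => by positivity
  have hH : ∀ i, C.commonEntropy i = Kc i := fun i => by
    rw [C.commonEntropy_eq (C.encC_injective hC (fun _ => hpow _) (fun _ => hpow _) i), hlog]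
  refine ⟨_, _, C, fun i => ⟨?_, ?_⟩, fun i => ⟨?_, ?_⟩, fun i => ?_⟩
  · rw [hlog, le_div_iff₀ hNpos, mul_comm]
    exact (hc3 i).le
  · rw [hlog, le_div_iff₀ hNpos, mul_comm]
    exact (hp3 i).le
  · rw [hH, hlog]
  · rw [hH, lt_div_iff₀ hNpos, mul_comm]
    exact hc3 i
  · rw [C.success_eq_one (hC i) (fun _ => hpow _) (fun _ => hpow _)]
    linarith

/-- Within a fibre of `f`, a correctly decoded message is determined by its output, and any two
outputs differ only in the lowest `capBits n i l` levels of each channel use. -/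
theorem SplitCode.card_correct_le (C : SplitCode n N Mc Mp) (i : Fin 2) (l : Fin 5)
    {τ : Type} [Fintype τ] [DecidableEq τ] (f : (∀ j, Fin (Mc j) × Fin (Mp j)) → τ)
    (hf : ∀ m m', f m = f m' → (l ∈ ({2, 3, 4} : Finset (Fin 5)) → (m i).1 = (m' i).1) ∧
      (l = 2 → (m i).2 = (m' i).2) ∧
      (l ∈ ({1, 4} : Finset (Fin 5)) → (m (other i)).1 = (m' (other i)).1) ∧
      (m (other i)).2 = (m' (other i)).2) :
    (Finset.univ.filter fun m : ∀ j, Fin (Mc j) × Fin (Mp j) =>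
      C.dec i (C.received i m) = ((m i).1, (m i).2, (m (other i)).1)).card ≤
      2 ^ (N * capBits n i l) * Fintype.card τ := by
  refine Finset.card_le_mul_card_image_of_maps_to (f := f) (fun _ _ => Finset.mem_univ _) _
    fun b _ => ?_
  refine card_le_of_sub_mem_lowBits (capBits_le_levels n i l) _ (C.received i) ?_ ?_
  · intro m hm m' hm' hmm
    simp only [Finset.coe_filter, Set.mem_ofPred_eq, Finset.mem_filter, Finset.mem_univ,
      true_and] at hm hm'
    have h1 := hm.1
    rw [hmm, hm'.1] at h1
    simp only [Prod.mk.injEq] at h1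
    obtain ⟨-, -, -, h4⟩ := hf m m' (hm.2.trans hm'.2.symm)
    exact funext ((forall_user (P := fun j => m j = m' j) i).2
      ⟨Prod.ext h1.1.symm h1.2.1.symm, Prod.ext h1.2.2.symm h4⟩)
  · intro m hm m' hm' t
    simp only [Finset.mem_filter, Finset.mem_univ, true_and] at hm hm'
    obtain ⟨h1, h2, h3, -⟩ := hf m m' (hm.2.trans hm'.2.symm)
    rw [SplitCode.received, SplitCode.received, ← outputOf_sub]
    refine outputOf_mem_lowBits ⟨fun hl => ?_, fun hl => ?_, fun hl => ?_⟩
    · simp [h1 hl]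
    · have := h1 (by simp [hl])
      simp [h2 hl, this]
    · simp [h3 hl]

theorem SplitCode.rateSums_le (C : SplitCode n N Mc Mp) {i : Fin 2} (h : 1 / 2 ≤ C.success i)
    (l : Fin 5) : rateSums (fun i => Real.logb 2 (Mc i)) (fun i => Real.logb 2 (Mp i)) i l ≤
      N * capBits n i l + 1 := by
  rw [SplitCode.success, denom_eq Mc Mp i] at h
  set S := (Finset.univ.filter fun m : ∀ j, Fin (Mc j) × Fin (Mp j) =>
      C.dec i (C.received i m) = ((m i).1, (m i).2, (m (other i)).1)).card
  have hden : (Mc i : ℝ) * Mp i * (Mc (other i) * Mp (other i)) ≠ 0 := by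
    intro h0
    rw [h0, div_zero] at h
    norm_num at h
  simp only [ne_eq, mul_eq_zero, not_or] at hden
  obtain ⟨⟨hci, hpi⟩, hco, hpo⟩ := hden
  have a1 : (0 : ℝ) < Mc i := (Nat.cast_nonneg _).lt_of_ne' hci
  have a2 : (0 : ℝ) < Mp i := (Nat.cast_nonneg _).lt_of_ne' hpi
  have a3 : (0 : ℝ) < Mc (other i) := (Nat.cast_nonneg _).lt_of_ne' hco
  have a4 : (0 : ℝ) < Mp (other i) := (Nat.cast_nonneg _).lt_of_ne' hpo
  rw [le_div_iff₀ (by positivity)] at h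
  -- `A` counts the messages bounded by the constraint and `B` the fibres fixed by `f`. At least
  -- half of the `A * B` message tuples are decoded correctly, which costs the one extra bit.
  have key : ∀ A B : ℝ, 0 < A → 0 < B → (S : ℝ) ≤ 2 ^ (N * capBits n i l) * B →
      A * B = Mc i * Mp i * (Mc (other i) * Mp (other i)) →
      Real.logb 2 A ≤ N * capBits n i l + 1 := by
    intro A B hA hB hS hAB
    have h1 : A ≤ 2 ^ (N * capBits n i l + 1) := by
      rw [pow_succ]
      rw [← hAB] at h
      refine le_of_mul_le_mul_right ?_ hB
      linarith
    have h2 := Real.logb_le_logb_of_le one_lt_two hA h1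
    rw [Real.logb_pow, Real.logb_self_eq_one one_lt_two] at h2
    push_cast at h2
    linarith
  have m2 : ∀ {x y : ℝ}, 0 < x → 0 < y →
      Real.logb 2 (x * y) = Real.logb 2 x + Real.logb 2 y :=
    fun hx hy => Real.logb_mul hx.ne' hy.ne'
  fin_cases l
  · have hS := C.card_correct_le i 0 (fun m => (m (other i)).2) fun m m' h => by simpa using h
    have := key (Mc i * Mp i * Mc (other i)) (Mp (other i)) (by positivity) a4
      (by exact_mod_cast (by simpa using hS)) (by ring)
    rwa [m2 (mul_pos a1 a2) a3, m2 a1 a2] at this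
  · have hS := C.card_correct_le i 1 (fun m => m (other i)) fun m m' h => by simp [h]
    have := key (Mc i * Mp i) (Mc (other i) * Mp (other i)) (by positivity) (by positivity)
      (by exact_mod_cast (by simpa using hS)) (by ring)
    rwa [m2 a1 a2] at this
  · have hS := C.card_correct_le i 2 (fun m => (m i, (m (other i)).2)) fun m m' h => by
      simp only [Prod.mk.injEq] at h
      simp [h]
    exact key (Mc (other i)) (Mc i * Mp i * Mp (other i)) (by positivity) (by positivity)
      (by exact_mod_cast (by simpa using hS)) (by ring)
  · have hS := C.card_correct_le i 3 (fun m => ((m i).1, (m (other i)).2)) fun m m' h => by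
      simp only [Prod.mk.injEq] at h
      simp [h]
    have := key (Mp i * Mc (other i)) (Mc i * Mp (other i)) (by positivity) (by positivity)
      (by exact_mod_cast (by simpa using hS)) (by ring)
    rwa [m2 a2 a3] at this
  · have hS := C.card_correct_le i 4 (fun m => ((m i).1, m (other i))) fun m m' h => by
      simp only [Prod.mk.injEq] at h
      simp [h]
    exact key (Mp i) (Mc i * (Mc (other i) * Mp (other i))) (by positivity) (by positivity)
      (by exact_mod_cast (by simpa using hS)) (by ring)

end Split

theorem inBitRegion_of_splitAchievable {n : Fin 2 → Fin 2 → ℕ} {rc rp : Fin 2 → ℝ}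
    (h : SplitAchievable n rc rp) : InBitRegion n rc rp := by
  obtain ⟨h0, h⟩ := h
  refine ⟨h0, fun i l => le_of_forall_pos_le_add fun η hη => ?_⟩
  -- A rate sum has at most three terms, each losing `η / 4`; the last quarter covers the extra bit
  -- divided by `N`.
  obtain ⟨N₀, hN₀⟩ := h (η / 4) (by positivity) (1 / 2) (by norm_num) (by norm_num)
  set N := max N₀ (⌈4 / η⌉₊ + 1)
  obtain ⟨Mc, Mp, C, hr, -, hs⟩ := hN₀ N (le_max_left _ _)
  have hNpos : (0 : ℝ) < N := by
    exact_mod_cast (Nat.succ_pos _).trans_le (le_max_right N₀ (⌈4 / η⌉₊ + 1))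
  have hNη : 1 / (N : ℝ) ≤ η / 4 := by
    have h1 : 4 / η ≤ N := (Nat.le_ceil _).trans (by
      exact_mod_cast (Nat.le_succ _).trans (le_max_right N₀ (⌈4 / η⌉₊ + 1)))
    rw [div_le_iff₀ hη] at h1
    rw [div_le_iff₀ hNpos]
    linarith
  have h1 := C.rateSums_le (i := i) (by linarith [hs i]) l
  have h2 : rateSums rc rp i l ≤
      rateSums (fun i => Real.logb 2 (Mc i)) (fun i => Real.logb 2 (Mp i)) i l / N +
        3 * (η / 4) := by
    have b1 := (hr i).1
    have b2 := (hr i).2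
    have b3 := (hr (other i)).1
    fin_cases l <;>
      simp only [rateSums, Fin.zero_eta, Fin.mk_one, Fin.reduceFinMk, Matrix.cons_val, add_div] <;>
      linarith
  have h3 : rateSums (fun i => Real.logb 2 (Mc i)) (fun i => Real.logb 2 (Mp i)) i l / N ≤
      capBits n i l + 1 / N := by
    rw [div_le_iff₀ hNpos, add_mul, div_mul_cancel₀ _ hNpos.ne']
    linarith
  linarith

theorem splitAchievable_iff_inBitRegion (n : Fin 2 → Fin 2 → ℕ) (rc rp : Fin 2 → ℝ) :
    SplitAchievable n rc rp ↔ InBitRegion n rc rp :=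
  ⟨inBitRegion_of_splitAchievable, splitAchievable_of_inBitRegion⟩

/-! ### From split codes to ordinary codes. -/

/-- A split code is a code whose message is the pair of common and private messages. -/
theorem achievable_of_splitAchievable {n : Fin 2 → Fin 2 → ℕ} {r rc rp : Fin 2 → ℝ}
    (hr : ∀ i, rc i + rp i = r i) (h : SplitAchievable n rc rp) : Achievable n r := by
  obtain ⟨h0, h⟩ := h
  refine ⟨fun i => by linarith [hr i, (h0 i).1, (h0 i).2], fun ε hε μ hμ hμ1 => ?_⟩
  obtain ⟨N₀, hN₀⟩ := h (ε / 2) (by positivity) μ hμ hμ1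
  refine ⟨N₀, fun N hN => ?_⟩
  obtain ⟨Mc, Mp, C, hrate, -, hs⟩ := hN₀ N hN
  have hne : (Mc 0 : ℝ) * Mp 0 * Mc 1 * Mp 1 ≠ 0 := by
    intro h0
    have := hs 0
    rw [SplitCode.success, h0, div_zero] at this
    linarith
  have hM : ∀ i, (Mc i : ℝ) ≠ 0 ∧ (Mp i : ℝ) ≠ 0 := by
    intro i
    rw [denom_eq Mc Mp i] at hne
    simp only [ne_eq, mul_eq_zero, not_or] at hne
    exact hne.1
  let e : ∀ i, Fin (Mc i * Mp i) ≃ Fin (Mc i) × Fin (Mp i) := fun i => finProdFinEquiv.symm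
  let D : Code n N (fun i => Mc i * Mp i) :=
    { enc := fun i a t => merge n i (C.encC i (e i a).1 t, C.encP i (e i a).1 (e i a).2 t)
      -- The decoded common message of the other user is discarded, so success can only become more
      -- likely.
      dec := fun i y => (e i).symm ((C.dec i y).1, (C.dec i y).2.1) }
  refine ⟨_, D, fun i => ?_, fun i => (hs i).trans ?_⟩
  · have := hrate i
    rw [Nat.cast_mul, Real.logb_mul (hM i).1 (hM i).2, add_div]
    linarith [hr i]
  · rw [SplitCode.success, Code.success]
    have hden : ((Mc 0 * Mp 0 : ℕ) : ℝ) * ((Mc 1 * Mp 1 : ℕ) : ℝ) =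
        Mc 0 * Mp 0 * Mc 1 * Mp 1 := by
      push_cast
      ring
    rw [hden]
    refine div_le_div_of_nonneg_right ?_ (by positivity)
    rw [Nat.cast_le]
    refine Finset.card_le_card_of_injOn (fun m j => (e j).symm (m j)) ?_ ?_
    · intro m hm
      simp only [Finset.coe_filter, Finset.mem_univ, true_and, Set.mem_ofPred_eq] at hm ⊢
      have hrec : D.received i (fun j => (e j).symm (m j)) = C.received i m := by
        funext t
        have : (fun j => D.enc j ((e j).symm (m j)) t) =
            fun j => merge n j (C.encC j (m j).1 t, C.encP j (m j).1 (m j).2 t) := by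
          funext j
          dsimp only [D]
          rw [Equiv.apply_symm_apply]
        exact congrArg (output n i) this
      rw [hrec]
      dsimp only [D]
      rw [hm]
    · intro m _ m' _ h
      exact funext fun j => (e j).symm.injective (congrFun h j)

/-! ### Entropy converse for arbitrary codes. -/

/-- A family indexed by both users as a pair. -/
noncomputable def userEquiv (β : Fin 2 → Type) (i : Fin 2) :
    (∀ j, β j) ≃ β i × β (other i) :=
  Equiv.ofBijective (fun m => (m i, m (other i)))
    ⟨fun m m' h => funext ((forall_user (P := fun j => m j = m' j) i).2 (Prod.mk.inj h)),
      fun ⟨a, b⟩ => by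
        classical
        have hne := (other_ne i).symm
        by_cases hβ : Nonempty (∀ j, β j)
        · refine ⟨Function.update (Function.update hβ.some i a) (other i) b, Prod.ext ?_ ?_⟩
          · exact (Function.update_of_ne hne _ _).trans (Function.update_self _ _ _)
          · exact Function.update_self _ _ _
        · exact (hβ (Classical.nonempty_pi.2 ((forall_user i).2 ⟨⟨a⟩, ⟨b⟩⟩))).elim⟩

/-- Input levels that `merge` sets to zero reach neither receiver, so every code acts through common
and private signals. -/
theorem output_ofInput (n : Fin 2 → Fin 2 → ℕ) (i : Fin 2) (v : Fin 2 → Bits (levels n)) :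
    outputOf n i (fun j => ofInput n j (v j)) = output n i v := by
  rw [outputOf, output, output]
  refine Finset.sum_congr rfl fun j _ => ?_
  have := gain_le_levels n i j
  funext k
  simp only [shiftDown]
  split_ifs with h
  · exact merge_ofInput_low n i j _ _ (by dsimp only; omega)
  · rfl

/-- A receiver that knows its own transmitter's signal can recover the common signal of the other
user. -/
theorem common_eq_of_outputOf_eq {n : Fin 2 → Fin 2 → ℕ} {i : Fin 2} {x x' : ∀ j, Signal n j}
    (h : x i = x' i) (hy : outputOf n i x = outputOf n i x') :
    (x (other i)).1 = (x' (other i)).1 := by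
  have hij := gain_le_levels n i (other i)
  have ho : n (other (other i)) (other i) = n i (other i) := by rw [other_other]
  funext k
  have hk := k.2
  have := congrFun hy ⟨k + (levels n - n i (other i)), by omega⟩
  rw [outputOf_apply, outputOf_apply, h] at this
  have := add_left_cancel this
  simpa [shiftDown, merge] using this

section Code

variable {n : Fin 2 → Fin 2 → ℕ} {N : ℕ} {M : Fin 2 → ℕ}

/-- The uniform law of the message of one user. -/
noncomputable def messageLaw (M : Fin 2 → ℕ) (j : Fin 2) : Fin (M j) → ℝ := fun _ => (M j : ℝ)⁻¹

/-- The uniform law of the messages of both users. -/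
noncomputable def messagesLaw (M : Fin 2 → ℕ) : (∀ j, Fin (M j)) → ℝ :=
  fun _ => ((M 0 : ℝ) * M 1)⁻¹

theorem messageLaw_mem (hM : ∀ j, M j ≠ 0) (j : Fin 2) :
    messageLaw M j ∈ stdSimplex ℝ (Fin (M j)) := by
  have : NeZero (M j) := ⟨hM j⟩
  have h := const_mem_stdSimplex (Fin (M j))
  rwa [Fintype.card_fin] at h

theorem messagesLaw_mem (hM : ∀ j, M j ≠ 0) :
    messagesLaw M ∈ stdSimplex ℝ (∀ j, Fin (M j)) := by
  have : ∀ j, NeZero (M j) := fun j => ⟨hM j⟩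
  have h := const_mem_stdSimplex (∀ j, Fin (M j))
  rw [Fintype.card_pi, Fin.prod_univ_two, Fintype.card_fin, Fintype.card_fin, Nat.cast_mul] at h
  exact h

theorem entropy_messages {α β : Type} [Fintype α] [DecidableEq α] [Fintype β] [DecidableEq β]
    (hM : ∀ j, M j ≠ 0) (i : Fin 2) (f : Fin (M i) → α) (g : Fin (M (other i)) → β) :
    entropy (messagesLaw M) (fun m => (f (m i), g (m (other i)))) =
      entropy (messageLaw M i) f + entropy (messageLaw M (other i)) g := by
  refine entropy_pair (userEquiv (fun j => Fin (M j)) i) (fun m => ?_) (messageLaw_mem hM i)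
    (messageLaw_mem hM (other i)) f g
  fin_cases i <;> simp [messagesLaw, messageLaw, mul_comm]

/-- The block of signals that user `j` effectively sends. -/
def Code.signal (C : Code n N M) (j : Fin 2) (a : Fin (M j)) : Fin N → Signal n j :=
  fun t => ofInput n j (C.enc j a t)

/-- The common part of the block of signals. -/
def Code.commonSignal (C : Code n N M) (j : Fin 2) (a : Fin (M j)) : Fin N → Common n j :=
  fun t => (C.signal j a t).1

theorem Code.received_eq (C : Code n N M) (i : Fin 2) (m : ∀ j, Fin (M j)) (t : Fin N) :
    C.received i m t = outputOf n i (fun j => C.signal j (m j) t) :=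
  (output_ofInput n i fun j => C.enc j (m j) t).symm

theorem Code.signal_eq_of_received_eq (C : Code n N M) {i : Fin 2} {m m' : ∀ j, Fin (M j)}
    (h : C.dec i (C.received i m) = m i) (h' : C.dec i (C.received i m') = m' i)
    (hy : C.received i m = C.received i m') :
    C.signal i (m i) = C.signal i (m' i) ∧
      C.commonSignal (other i) (m (other i)) = C.commonSignal (other i) (m' (other i)) := by
  have hm : m i = m' i := by rw [← h, hy, h']
  have hs : C.signal i (m i) = C.signal i (m' i) := by rw [hm]
  refine ⟨hs, funext fun t => ?_⟩
  have := congrFun hy t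
  rw [C.received_eq, C.received_eq] at this
  exact common_eq_of_outputOf_eq (congrFun hs t) this

theorem Code.error_le (C : Code n N M) (hM : ∀ j, M j ≠ 0) {i : Fin 2} {μ : ℝ}
    (h : 1 - μ ≤ C.success i) :
    ∑ m, messagesLaw M m * (if C.dec i (C.received i m) = m i then 0 else 1) ≤ μ := by
  have h1 : ∑ m, messagesLaw M m * (if C.dec i (C.received i m) = m i then 1 else 0) =
      C.success i := by
    simp only [messagesLaw]
    rw [← Finset.mul_sum, Finset.sum_boole, Code.success, div_eq_inv_mul]
  have h2 : ∑ m, messagesLaw M m * (if C.dec i (C.received i m) = m i then 0 else 1) =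
      1 - C.success i := by
    rw [← h1, eq_sub_iff_add_eq, ← Finset.sum_add_distrib]
    refine Eq.trans ?_ (messagesLaw_mem hM).2
    refine Finset.sum_congr rfl fun m _ => ?_
    split_ifs <;> simp
  linarith

/-- Fano's inequality in the form of an expected code length. -/
theorem Code.condEntropy_le (C : Code n N M) (hM : ∀ j, M j ≠ 0) {i : Fin 2} {μ : ℝ}
    (h : 1 - μ ≤ C.success i) {α γ : Type} [Fintype α] [DecidableEq α] [Fintype γ] [DecidableEq γ]
    (X : (∀ j, Fin (M j)) → α) (Z : (∀ j, Fin (M j)) → γ) (D : ℕ)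
    (hcard : ∀ z, ∀ S : Finset α, (∀ a ∈ S, ∃ m, C.dec i (C.received i m) = m i ∧ X m = a ∧ Z m = z) →
      S.card ≤ 2 ^ D) :
    condEntropy (messagesLaw M) X Z ≤ D + 1 + μ * Real.logb 2 (Fintype.card α) := by
  classical
  have hp := messagesLaw_mem hM
  have : ∀ j, NeZero (M j) := fun j => ⟨hM j⟩
  have : Nonempty α := ⟨X fun _ => 0⟩
  have hA : (0 : ℝ) < Fintype.card α := by exact_mod_cast Fintype.card_pos
  have hA1 : (1 : ℝ) ≤ Fintype.card α := by exact_mod_cast Fintype.card_pos (α := α)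
  have hlog : 0 ≤ Real.logb 2 (Fintype.card α) := Real.logb_nonneg one_lt_two hA1
  set G : α → γ → Prop := fun a z => ∃ m, C.dec i (C.received i m) = m i ∧ X m = a ∧ Z m = z
  have hw1 : (0 : ℝ) < (2 ^ (D + 1))⁻¹ := by positivity
  have hw2 : (0 : ℝ) < (2 * (Fintype.card α : ℝ))⁻¹ := by positivity
  have hpos : ∀ a z, 0 < if G a z then ((2 : ℝ) ^ (D + 1))⁻¹ else (2 * (Fintype.card α : ℝ))⁻¹ := by
    intro a z
    split_ifs
    exacts [hw1, hw2]
  -- Half of the weight is reserved for the at most `2 ^ D` values arising from correct decoding,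
  -- costing `D + 1` bits each. The other half is uniform over `α` and is needed only when decoding
  -- fails.
  refine (condEntropy_le_of_weight hp X Z
    (fun a z => if G a z then (2 ^ (D + 1))⁻¹ else (2 * (Fintype.card α : ℝ))⁻¹)
    (fun a z => (hpos a z).le) (fun m => hpos _ _) ?_).trans ?_
  · intro z
    rw [Finset.sum_ite, Finset.sum_const, Finset.sum_const, nsmul_eq_mul, nsmul_eq_mul]
    have h1 : ((Finset.univ.filter fun a => G a z).card : ℝ) ≤ 2 ^ D := by
      exact_mod_cast hcard z _ fun a ha => (Finset.mem_filter.1 ha).2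
    have h2 : ((Finset.univ.filter fun a => ¬ G a z).card : ℝ) ≤ Fintype.card α := by
      exact_mod_cast Finset.card_le_univ _
    have e1 : ((2 : ℝ) ^ D) * (2 ^ (D + 1))⁻¹ = 1 / 2 := by
      rw [pow_succ]
      field_simp
    have e2 : (Fintype.card α : ℝ) * (2 * (Fintype.card α : ℝ))⁻¹ = 1 / 2 := by
      field_simp
    have := mul_le_mul_of_nonneg_right h1 hw1.le
    have := mul_le_mul_of_nonneg_right h2 hw2.le
    linarith
  · have hterm : ∀ m, messagesLaw M m * -Real.logb 2 (if G (X m) (Z m) then (2 ^ (D + 1))⁻¹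
        else (2 * (Fintype.card α : ℝ))⁻¹) ≤ messagesLaw M m * (D + 1) +
        messagesLaw M m * (if C.dec i (C.received i m) = m i then 0 else 1) *
          Real.logb 2 (Fintype.card α) := by
      intro m
      rw [mul_assoc, ← mul_add]
      refine mul_le_mul_of_nonneg_left ?_ (hp.1 m)
      have l1 : -Real.logb 2 ((2 : ℝ) ^ (D + 1))⁻¹ = D + 1 := by
        rw [Real.logb_inv, neg_neg, Real.logb_pow, Real.logb_self_eq_one one_lt_two, mul_one]
        push_cast
        rfl
      have l2 : -Real.logb 2 (2 * (Fintype.card α : ℝ))⁻¹ = 1 + Real.logb 2 (Fintype.card α) := by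
        rw [Real.logb_inv, neg_neg, Real.logb_mul two_ne_zero hA.ne',
          Real.logb_self_eq_one one_lt_two]
      by_cases hm : C.dec i (C.received i m) = m i
      · rw [if_pos (show G (X m) (Z m) from ⟨m, hm, rfl, rfl⟩), if_pos hm, l1]
        simp
      · have hD : (0 : ℝ) ≤ D := D.cast_nonneg
        rw [if_neg hm]
        split_ifs
        · rw [l1]
          linarith
        · rw [l2]
          linarith
    refine (Finset.sum_le_sum fun m _ => hterm m).trans ?_
    rw [Finset.sum_add_distrib, ← Finset.sum_mul, ← Finset.sum_mul, hp.2, one_mul]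
    have := mul_le_mul_of_nonneg_right (C.error_le hM h) hlog
    linarith

/-- Entropy of the block of signals of user `j`. -/
noncomputable def Code.signalEntropy (C : Code n N M) (j : Fin 2) : ℝ :=
  entropy (messageLaw M j) (C.signal j)

/-- Entropy of the block of common signals of user `j`. -/
noncomputable def Code.commonSignalEntropy (C : Code n N M) (j : Fin 2) : ℝ :=
  entropy (messageLaw M j) (C.commonSignal j)

/-- Given its own signal block and the other message, the output is known, so correct decoding
leaves one candidate (`D = 0`). Independence of the users turns the remaining conditional entropy
into `log M_i - H(signal)`. -/
theorem Code.logb_le (C : Code n N M) (hM : ∀ j, M j ≠ 0) {i : Fin 2} {μ : ℝ}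
    (h : 1 - μ ≤ C.success i) :
    (1 - μ) * Real.logb 2 (M i) ≤ C.signalEntropy i + 1 := by
  have h1 := C.condEntropy_le hM h (fun m => m i) (fun m => (C.signal i (m i), m (other i))) 0 (by
    rintro z S hS
    rw [pow_zero, Finset.card_le_one]
    intro a ha b hb
    obtain ⟨m, hm, rfl, hz⟩ := hS a ha
    obtain ⟨m', hm', rfl, hz'⟩ := hS b hb
    have hzz := hz.trans hz'.symm
    simp only [Prod.mk.injEq] at hzz
    have hr : C.received i m = C.received i m' := by
      funext t
      rw [C.received_eq, C.received_eq]
      exact outputOf_congr (congrFun hzz.1 t) (by rw [hzz.2])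
    rw [← hm, hr, hm'])
  rw [condEntropy_eq_sub (V := fun m => (id (m i), id (m (other i))))] at h1
  swap
  · intro m m'
    simp only [Prod.mk.injEq, id]
    exact ⟨fun h => ⟨h.1, h.2.2⟩, fun h => ⟨h.1, by rw [h.1], h.2⟩⟩
  have e2 := entropy_messages hM i (C.signal i) (id : Fin (M (other i)) → Fin (M (other i)))
  have e3 : entropy (messageLaw M i) (id : Fin (M i) → Fin (M i)) = Real.logb 2 (M i) := by
    rw [entropy_uniform_injective (by simp [messageLaw]) Function.injective_id, Fintype.card_fin]
  simp only [id] at e2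
  rw [e2, entropy_messages hM i id id, e3, Fintype.card_fin] at h1
  change _ ≤ entropy (messageLaw M i) (C.signal i) + 1
  push_cast at h1
  linarith

/-- The left side is `H(X | Z)` for `X` the own signal and the interferer's common signal, and `Z`
the parts kept by `f` and `g`. After correct decoding the output determines `X`, and for fixed `Z`
the outputs form at most `2 ^ (N * capBits n i l)` blocks. -/
theorem Code.entropy_sub_le (C : Code n N M) (hM : ∀ j, M j ≠ 0) {i : Fin 2} {μ : ℝ} (hμ : 0 ≤ μ)
    (h : 1 - μ ≤ C.success i) (l : Fin 5) {α β : Type} [Fintype α] [DecidableEq α]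
    [Fintype β] [DecidableEq β] (f : (Fin N → Signal n i) → α)
    (g : (Fin N → Common n (other i)) → β)
    (hf : ∀ x x', f x = f x' → ∀ t, (l ∈ ({2, 3, 4} : Finset (Fin 5)) → (x t).1 = (x' t).1) ∧
      (l = 2 → (x t).2 = (x' t).2))
    (hg : ∀ x x', g x = g x' → ∀ t, l ∈ ({1, 4} : Finset (Fin 5)) → x t = x' t) :
    C.signalEntropy i + C.commonSignalEntropy (other i) -
      (entropy (messageLaw M i) (fun a => f (C.signal i a)) +
        entropy (messageLaw M (other i)) (fun a => g (C.commonSignal (other i) a))) ≤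
      N * capBits n i l + 1 + μ * (N * (3 * levels n)) := by
  set X : (∀ j, Fin (M j)) → (Fin N → Signal n i) × (Fin N → Common n (other i)) :=
    fun m => (C.signal i (m i), C.commonSignal (other i) (m (other i)))
  set Z : (∀ j, Fin (M j)) → α × β :=
    fun m => (f (C.signal i (m i)), g (C.commonSignal (other i) (m (other i))))
  have h1 := C.condEntropy_le hM h X Z (N * capBits n i l) (by
    intro z S hS
    have : ∀ j, NeZero (M j) := fun j => ⟨hM j⟩
    choose! m hm1 hm2 hm3 using hS
    refine card_le_of_sub_mem_lowBits (capBits_le_levels n i l) S (fun a => C.received i (m a)) ?_ ?_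
    · intro a ha b hb hab
      rw [← hm2 a ha, ← hm2 b hb]
      obtain ⟨k1, k2⟩ := C.signal_eq_of_received_eq (hm1 a ha) (hm1 b hb) hab
      exact Prod.ext k1 k2
    · intro a ha b hb t
      have hz : Z (m a) = Z (m b) := (hm3 a ha).trans (hm3 b hb).symm
      simp only [Z, Prod.mk.injEq] at hz
      have kf := hf _ _ hz.1 t
      have kg := hg _ _ hz.2 t
      rw [C.received_eq, C.received_eq, ← outputOf_sub]
      refine outputOf_mem_lowBits ⟨fun hl => ?_, fun hl => ?_, fun hl => ?_⟩
      · simp [kf.1 hl]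
      · simp [kf.2 hl]
      · exact sub_eq_zero.2 (kg hl))
  rw [condEntropy_eq_sub (V := X)] at h1
  swap
  · intro m m'
    simp only [X, Z, Prod.mk.injEq]
    exact ⟨fun h => h.1, fun h => ⟨h, by rw [h.1], by rw [h.2]⟩⟩
  have hcard : Real.logb 2 (Fintype.card ((Fin N → Signal n i) × (Fin N → Common n (other i)))) ≤
      N * (3 * levels n) := by
    have : Fintype.card ((Fin N → Signal n i) × (Fin N → Common n (other i))) =
        2 ^ (N * (n (other i) i + (n i i - n (other i) i) + n (other (other i)) (other i))) := by
      simp only [Fintype.card_prod, Fintype.card_fun, ZMod.card, Fintype.card_fin]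
      rw [← pow_add, ← pow_mul, ← pow_mul, ← pow_add]
      congr 1
      ring
    rw [this, Nat.cast_pow, Nat.cast_ofNat, Real.logb_pow, Real.logb_self_eq_one one_lt_two,
      mul_one]
    have a1 := gain_le_levels n (other i) i
    have a2 := gain_le_levels n i i
    have a3 := gain_le_levels n (other (other i)) (other i)
    have : n (other i) i + (n i i - n (other i) i) + n (other (other i)) (other i) ≤
      3 * levels n := by omega
    exact_mod_cast Nat.mul_le_mul_left N this
  have e2 := entropy_messages hM i (C.signal i) (C.commonSignal (other i))
  have e3 := entropy_messages hM i (fun a => f (C.signal i a))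
    (fun a => g (C.commonSignal (other i) a))
  rw [e2, e3] at h1
  have := mul_le_mul_of_nonneg_left hcard hμ
  rw [Code.signalEntropy, Code.commonSignalEntropy]
  push_cast at h1
  linarith

theorem Code.rateSums_le (C : Code n N M) (hM : ∀ j, M j ≠ 0) {i : Fin 2} {μ : ℝ} (hμ : 0 ≤ μ)
    (h : 1 - μ ≤ C.success i) (l : Fin 5) :
    rateSums C.commonSignalEntropy (fun j => C.signalEntropy j - C.commonSignalEntropy j) i l ≤
      N * capBits n i l + 1 + μ * (N * (3 * levels n)) := by
  have z1 := entropy_const (messageLaw_mem hM i).2 ()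
  have z2 := entropy_const (messageLaw_mem hM (other i)).2 ()
  have s1 : entropy (messageLaw M i) (fun a => C.signal i a) = C.signalEntropy i := rfl
  have s2 : entropy (messageLaw M i) (fun a t => (C.signal i a t).1) =
    C.commonSignalEntropy i := rfl
  have s3 : entropy (messageLaw M (other i)) (fun a => C.commonSignal (other i) a) =
    C.commonSignalEntropy (other i) := rfl
  fin_cases l
  · have := C.entropy_sub_le hM hμ h 0 (fun _ => ()) (fun _ => ()) (by simp) (by simp)
    rw [z1, z2] at this
    simp only [rateSums, Fin.zero_eta, Matrix.cons_val_zero]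
    linarith
  · have := C.entropy_sub_le hM hμ h 1 (fun _ => ()) (fun x => x) (by simp)
      (fun x x' h t _ => congrFun h t)
    rw [z1, s3] at this
    simp only [rateSums, Fin.mk_one, Matrix.cons_val]
    linarith
  · have := C.entropy_sub_le hM hμ h 2 (fun x => x) (fun _ => ())
      (fun x x' h t => by simp [congrFun h t]) (by simp)
    rw [s1, z2] at this
    simp only [rateSums, Fin.reduceFinMk, Matrix.cons_val]
    linarith
  · have := C.entropy_sub_le hM hμ h 3 (fun x t => (x t).1) (fun _ => ())
      (fun x x' h t => ⟨fun _ => congrFun h t, fun h => absurd h (by decide)⟩) (by simp)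
    rw [s2, z2] at this
    simp only [rateSums, Fin.reduceFinMk, Matrix.cons_val]
    linarith
  · have := C.entropy_sub_le hM hμ h 4 (fun x t => (x t).1) (fun x => x)
      (fun x x' h t => ⟨fun _ => congrFun h t, fun h => absurd h (by decide)⟩)
      (fun x x' h t _ => congrFun h t)
    rw [s2, s3] at this
    simp only [rateSums, Fin.reduceFinMk, Matrix.cons_val]
    linarith

end Code

/-! ### From approximate to exact rate splits. -/

theorem exists_approximate_split {n : Fin 2 → Fin 2 → ℕ} {r : Fin 2 → ℝ} (h : Achievable n r)
    {δ : ℝ} (hδ : 0 < δ) : ∃ rc rp : Fin 2 → ℝ, (∀ i, 0 ≤ rc i ∧ 0 ≤ rp i) ∧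
      (∀ i l, rateSums rc rp i l ≤ capBits n i l + δ) ∧ ∀ i, r i - δ ≤ rc i + rp i := by
  obtain ⟨h0, h⟩ := h
  -- `η * T` bounds all losses: the Fano term `η * (3 * levels n)`, the factor `1 - η` on the rates,
  -- the rate slack `η`, and `1 / N ≤ η`.
  set T : ℝ := 3 * levels n + r 0 + r 1 + 2
  have hT : 0 < T := by
    have := h0 0
    have := h0 1
    positivity
  set η := min (δ / T) (1 / 2)
  have hη : 0 < η := lt_min (div_pos hδ hT) (by norm_num)
  have hη1 : η ≤ 1 / 2 := min_le_right _ _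
  have hηT : η * T ≤ δ := by
    rw [← le_div_iff₀ hT]
    exact min_le_left _ _
  obtain ⟨N₀, hN₀⟩ := h η hη η hη (by linarith)
  set N := max N₀ (⌈1 / η⌉₊ + 1)
  obtain ⟨M, C, hr, hs⟩ := hN₀ N (le_max_left _ _)
  have hNpos : (0 : ℝ) < N := by
    exact_mod_cast (Nat.succ_pos _).trans_le (le_max_right N₀ (⌈1 / η⌉₊ + 1))
  have hNη : 1 / (N : ℝ) ≤ η := by
    have h1 : 1 / η ≤ N := (Nat.le_ceil _).trans (by
      exact_mod_cast (Nat.le_succ _).trans (le_max_right N₀ (⌈1 / η⌉₊ + 1)))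
    rw [div_le_iff₀ hη] at h1
    rw [div_le_iff₀ hNpos]
    linarith
  have hM : ∀ j, M j ≠ 0 := by
    have hne : (M 0 : ℝ) * M 1 ≠ 0 := by
      intro h0
      have := hs 0
      rw [Code.success, h0, div_zero] at this
      linarith
    simp only [ne_eq, mul_eq_zero, not_or, Nat.cast_eq_zero] at hne
    exact Fin.forall_fin_two.2 hne
  have hL : (0 : ℝ) ≤ levels n := Nat.cast_nonneg _
  have expand : η * T = η * (3 * levels n) + η * r 0 + η * r 1 + 2 * η := by
    simp only [T]
    ring
  have p0 := mul_nonneg hη.le (h0 0)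
  have p1 := mul_nonneg hη.le (h0 1)
  have p2 := mul_nonneg hη.le hL
  -- The private rate is the conditional entropy of the signal given its common part, since the
  -- latter is a function of the former.
  refine ⟨fun j => C.commonSignalEntropy j / N,
    fun j => (C.signalEntropy j - C.commonSignalEntropy j) / N, fun j => ⟨?_, ?_⟩,
    fun i l => ?_, fun i => ?_⟩
  · exact div_nonneg (entropy_nonneg (messageLaw_mem hM j) _) hNpos.le
  · refine div_nonneg (sub_nonneg.2 (entropy_le_of_factors (messageLaw_mem hM j).1 ?_)) hNpos.le
    intro a a' haa
    funext t
    rw [Code.commonSignal, Code.commonSignal, haa]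
  · have h1 := C.rateSums_le hM hη.le (hs i) l
    have h2 : rateSums (fun j => C.commonSignalEntropy j / N)
        (fun j => (C.signalEntropy j - C.commonSignalEntropy j) / N) i l =
        rateSums C.commonSignalEntropy
          (fun j => C.signalEntropy j - C.commonSignalEntropy j) i l / N := by
      fin_cases l <;>
        simp only [rateSums, Fin.zero_eta, Fin.mk_one, Fin.reduceFinMk, Matrix.cons_val, add_div]
    rw [h2]
    have h3 : rateSums C.commonSignalEntropy
          (fun j => C.signalEntropy j - C.commonSignalEntropy j) i l / N ≤
        capBits n i l + 1 / N + η * (3 * levels n) := by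
      rw [div_le_iff₀ hNpos, add_mul, add_mul, div_mul_cancel₀ _ hNpos.ne']
      linarith
    linarith
  · have h1 := C.logb_le hM (hs i)
    have h2 : (1 - η) * (Real.logb 2 (M i) / N) ≤ C.signalEntropy i / N + 1 / N := by
      rw [← add_div, ← mul_div_assoc]
      exact div_le_div_of_nonneg_right h1 hNpos.le
    have h3 := mul_le_mul_of_nonneg_left (hr i) (by linarith : (0 : ℝ) ≤ 1 - η)
    have h4 : η * r i ≤ η * r 0 + η * r 1 := by
      fin_cases i
      · change η * r 0 ≤ _
        linarith
      · change η * r 1 ≤ _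
        linarith
    rw [← add_div, add_sub_cancel]
    nlinarith [mul_pos hη hη]

/-- The approximate splits for `δ = 1 / (k + 1)` stay in a compact box, and a limit point satisfies
all constraints exactly, with sums at least `r`. -/
theorem exists_split_of_achievable {n : Fin 2 → Fin 2 → ℕ} {r : Fin 2 → ℝ} (h : Achievable n r) :
    ∃ rc rp : Fin 2 → ℝ, (∀ i, rc i + rp i = r i) ∧ InBitRegion n rc rp := by
  choose rc rp h0 h1 h2 using fun k : ℕ =>
    exists_approximate_split h (Nat.one_div_pos_of_nat (α := ℝ) (n := k))
  -- Constraint `1` bounds the sum of both rates of a user, and `δ ≤ 1`.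
  set B : Fin 2 → ℝ := fun i => capBits n i 1 + 1
  have hδ : ∀ k : ℕ, 1 / ((k : ℝ) + 1) ≤ 1 := fun k => by
    rw [div_le_one (by positivity)]
    linarith [k.cast_nonneg (α := ℝ)]
  have hB : ∀ k i, rc k i + rp k i ≤ B i := fun k i => (h1 k i 1).trans (by
    simp only [B]
    linarith [hδ k])
  have hmem : ∀ k, (rc k, rp k) ∈ Set.Icc 0 B ×ˢ Set.Icc 0 B := by
    intro k
    refine ⟨⟨fun i => (h0 k i).1, fun i => ?_⟩, ⟨fun i => (h0 k i).2, fun i => ?_⟩⟩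
    · linarith [hB k i, (h0 k i).2]
    · linarith [hB k i, (h0 k i).1]
  obtain ⟨⟨ac, ap⟩, ⟨hac, hap⟩, φ, hφ, hlim⟩ :=
    (isCompact_Icc.prod isCompact_Icc).tendsto_subseq hmem
  have lc : ∀ i, Filter.Tendsto (fun k => rc (φ k) i) Filter.atTop (nhds (ac i)) := fun i =>
    ((continuous_apply i).tendsto ac).comp ((continuous_fst.tendsto (ac, ap)).comp hlim)
  have lp : ∀ i, Filter.Tendsto (fun k => rp (φ k) i) Filter.atTop (nhds (ap i)) := fun i =>
    ((continuous_apply i).tendsto ap).comp ((continuous_snd.tendsto (ac, ap)).comp hlim)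
  have lδ : Filter.Tendsto (fun k => 1 / (((φ k : ℕ) : ℝ) + 1)) Filter.atTop (nhds 0) :=
    tendsto_one_div_add_atTop_nhds_zero_nat.comp hφ.tendsto_atTop
  have hsum : ∀ i l, rateSums ac ap i l ≤ capBits n i l := by
    intro i l
    have t1 : Filter.Tendsto (fun k => rateSums (rc (φ k)) (rp (φ k)) i l) Filter.atTop
        (nhds (rateSums ac ap i l)) := by
      fin_cases l
      · exact ((lc i).add (lp i)).add (lc (other i))
      · exact (lc i).add (lp i)
      · exact lc (other i)
      · exact (lp i).add (lc (other i))
      · exact lp i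
    have t2 := lδ.const_add (capBits n i l : ℝ)
    rw [add_zero] at t2
    exact le_of_tendsto_of_tendsto' t1 t2 fun k => h1 (φ k) i l
  have hrate : ∀ i, r i ≤ ac i + ap i := by
    intro i
    have t2 := lδ.const_sub (r i)
    rw [sub_zero] at t2
    exact le_of_tendsto_of_tendsto' t2 ((lc i).add (lp i)) fun k => h2 (φ k) i
  have hr0 := h.1
  have bc : ∀ i, min (ac i) (r i) ≤ ac i := fun i => min_le_left _ _
  have bp : ∀ i, r i - min (ac i) (r i) ≤ ap i := fun i => by
    rcases min_choice (ac i) (r i) with e | e <;> rw [e]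
    · linarith [hrate i]
    · have : 0 ≤ ap i := hap.1 i
      linarith
  -- The excess over `r` is cut off. Both parts only decrease, and the constraints are monotone in
  -- the rates.
  refine ⟨fun i => min (ac i) (r i), fun i => r i - min (ac i) (r i), fun i => by ring,
    fun i => ⟨le_min (hac.1 i) (hr0 i), sub_nonneg.2 (min_le_right _ _)⟩, fun i l =>
      le_trans ?_ (hsum i l)⟩
  have b1 := bc i
  have b2 := bp i
  have b3 := bc (other i)
  fin_cases l <;>
    simp only [rateSums, Fin.zero_eta, Fin.mk_one, Fin.reduceFinMk, Matrix.cons_val] <;>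
    linarith

end DetIC

theorem lemmal (n : Fin 2 → Fin 2 → ℕ) :
    -- splitting into common and private messages, with both receivers decoding both common ones
    (∀ r : Fin 2 → ℝ, DetIC.Achievable n r ↔
      ∃ rc rp : Fin 2 → ℝ, (∀ i, rc i + rp i = r i) ∧ DetIC.SplitAchievable n rc rp) ∧
    -- the rates of such codes form exactly the single-letter compound-MAC region
    (∀ rc rp : Fin 2 → ℝ, DetIC.SplitAchievable n rc rp ↔ DetIC.InMACRegion n rc rp) ∧
    -- uniform signals maximize all ten mutual informations simultaneously
    (∀ (k : ℕ) (p : DetIC.InputLaw n (Fin k)) (i : Fin 2) (l : Fin 5),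
      p.info i l ≤ (DetIC.uniformLaw n).info i l) ∧
    -- the region is the one of uniform signals, and it is given by the explicit constraints
    (∀ rc rp : Fin 2 → ℝ, DetIC.InMACRegion n rc rp ↔ (DetIC.uniformLaw n).InRegion rc rp) ∧
    (∀ rc rp : Fin 2 → ℝ, DetIC.InMACRegion n rc rp ↔ DetIC.InExplicitRegion n rc rp) := by
  refine ⟨fun r => ⟨fun h => ?_, ?_⟩, fun rc rp => ?_, fun k p i l => ?_, fun rc rp => ?_,
    fun rc rp => ?_⟩
  · obtain ⟨rc, rp, hr, hreg⟩ := DetIC.exists_split_of_achievable h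
    exact ⟨rc, rp, hr, DetIC.splitAchievable_of_inBitRegion hreg⟩
  · rintro ⟨rc, rp, hr, h⟩
    exact DetIC.achievable_of_splitAchievable hr h
  · rw [DetIC.splitAchievable_iff_inBitRegion, DetIC.inMACRegion_iff_inBitRegion]
  · rw [DetIC.uniformLaw_info]
    exact p.info_le i l
  · rw [DetIC.uniformLaw_inRegion_iff, DetIC.inMACRegion_iff_inBitRegion]
  · rw [DetIC.inExplicitRegion_iff_inBitRegion, DetIC.inMACRegion_iff_inBitRegion]
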